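/- **Theorem 2.3.** Let $(M,g,J)$ be a compact connected Kähler manifold with Levi-Civita connection $\nabla$, and let $\mathcal F$ be a smooth foliation of $M$ by complex curves, that is, its tangent distribution $\mathcal D=T\mathcal F\subset TM$ is smooth, involutive, of real rank $2$ and satisfies $J\mathcal D\subseteq\mathcal D$. Suppose that * $\mathcal F$ is totally geodesic: $\nabla_XX\in\Gamma(\mathcal D)$ for every $X\in\Gamma(\mathcal D)$; * $\mathcal F$ is conformal and homothetic: there is a smooth one-form $\theta$ on $M$ with $\theta|_{\mathcal D^\perp}=0$ and $d\theta=0$ such that $(L_Vg)(X,Y)=\theta(V)\,g(X,Y)$ for all $V\in\Gamma(\mathcal D)$ and $X,Y\in\Gamma(\mathcal D^\perp)$; * $\theta$ does not vanish identically on $M$. Then $\mathcal F$ is holomorphic on all of $M$: $(L_VJ)X\in\Gamma(\mathcal D)$ for every $V\in\Gamma(\mathcal D)$ and every smooth vector field $X$ on $M$. -/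

import Mathlib

open Bundle VectorField
open scoped Manifold ContDiff

namespace KahlerFoliation

variable {E : Type*} [NormedAddCommGroup E] [NormedSpace ℝ E]
  {M : Type*} [TopologicalSpace M] [ChartedSpace E M] [IsManifold 𝓘(ℝ, E) ∞ M]

/-- A smooth Riemannian metric on `M`. -/
abbrev Metric (E : Type*) [NormedAddCommGroup E] [NormedSpace ℝ E]
    (M : Type*) [TopologicalSpace M] [ChartedSpace E M] [IsManifold 𝓘(ℝ, E) ∞ M] :=
  ContMDiffRiemannianMetric 𝓘(ℝ, E) ∞ E (fun x : M => TangentSpace 𝓘(ℝ, E) x)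

/-- The function `g(X, Y)`. -/
noncomputable def pairing (g : Metric E M) (X Y : Π x : M, TangentSpace 𝓘(ℝ, E) x) (x : M) : ℝ :=
  g.inner x (X x) (Y x)

theorem pairing_mdiff (g : Metric E M) {X Y : Π x : M, TangentSpace 𝓘(ℝ, E) x} {x : M}
    (hX : MDiffAt (T% X) x) (hY : MDiffAt (T% Y) x) : MDiffAt (pairing g X Y) x := by
  have h := MDifferentiableAt.clm_bundle_apply₂ (F₁ := E) (F₂ := E) (F₃ := ℝ)
     (E₁ := fun x : M => TangentSpace 𝓘(ℝ, E) x) (E₂ := fun x : M => TangentSpace 𝓘(ℝ, E) x)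
     (E₃ := Bundle.Trivial M ℝ) 
    ((g.contMDiff.contMDiffAt (x := x)).mdifferentiableAt (by simp)) hX hY
  simp only [mdifferentiableAt_totalSpace] at h
  exact h.2

/-- Koszul's expression, which equals `2 g(∇_X Y, Z)` for the Levi-Civita connection `∇`. -/
noncomputable def koszul (g : Metric E M) (X Y Z : Π x : M, TangentSpace 𝓘(ℝ, E) x) (x : M) : ℝ :=
  mvfderiv 𝓘(ℝ, E) (pairing g Y Z) x (X x)
  + mvfderiv 𝓘(ℝ, E) (pairing g Z X) x (Y x)
  - mvfderiv 𝓘(ℝ, E) (pairing g X Y) x (Z x)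
  + g.inner x (mlieBracket 𝓘(ℝ, E) X Y x) (Z x)
  - g.inner x (mlieBracket 𝓘(ℝ, E) Y Z x) (X x)
  + g.inner x (mlieBracket 𝓘(ℝ, E) Z X x) (Y x)

section pairing
variable (g : Metric E M) (X X' Y : Π x : M, TangentSpace 𝓘(ℝ, E) x) (f : M → ℝ)
theorem pairing_comm : pairing g X Y = pairing g Y X := funext fun x => g.symm x _ _
theorem pairing_add_left : pairing g (X + X') Y = pairing g X Y + pairing g X' Y := by
  ext x; simp [pairing]
theorem pairing_smul_left : pairing g (f • X) Y = f * pairing g X Y := by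
  ext x; simp [pairing]
theorem pairing_add_right : pairing g Y (X + X') = pairing g Y X + pairing g Y X' := by
  ext x; simp [pairing]
theorem pairing_smul_right : pairing g Y (f • X) = f * pairing g Y X := by
  ext x; simp [pairing]
end pairing

section
variable [FiniteDimensional ℝ E]

theorem koszul_tensorial_left (g : Metric E M) {Y Z : Π x : M, TangentSpace 𝓘(ℝ, E) x} {x : M}
    (hY : MDiffAt (T% Y) x) (hZ : MDiffAt (T% Z) x) :
    TensorialAt 𝓘(ℝ, E) E (koszul g · Y Z x) x where
  smul {f X} hf hX := by
    simp only [koszul, pairing_smul_left, pairing_smul_right]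
    rw [mvfderiv_mul hf (pairing_mdiff g hZ hX), mvfderiv_mul hf (pairing_mdiff g hX hY),
      mlieBracket_smul_left hf hX, mlieBracket_smul_right hf hX]
    simp [pairing]
    rw [g.symm x (X x) (Z x)]
    ring
  add {X X'} hX hX' := by
    simp only [koszul, pairing_add_left, pairing_add_right]
    rw [mvfderiv_add (pairing_mdiff g hZ hX) (pairing_mdiff g hZ hX'),
      mvfderiv_add (pairing_mdiff g hX hY) (pairing_mdiff g hX' hY),
      mlieBracket_add_left hX hX', mlieBracket_add_right hX hX']
    simp
    ring

theorem koszul_tensorial_right (g : Metric E M) {X Y : Π x : M, TangentSpace 𝓘(ℝ, E) x} {x : M}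
    (hX : MDiffAt (T% X) x) (hY : MDiffAt (T% Y) x) :
    TensorialAt 𝓘(ℝ, E) E (koszul g X Y · x) x where
  smul {f Z} hf hZ := by
    simp only [koszul, pairing_smul_left, pairing_smul_right]
    rw [mvfderiv_mul hf (pairing_mdiff g hZ hX), mvfderiv_mul hf (pairing_mdiff g hY hZ),
      mlieBracket_smul_left hf hZ, mlieBracket_smul_right hf hZ]
    simp [pairing]
    rw [g.symm x (Y x) (Z x)]
    ring
  add {Z Z'} hZ hZ' := by
    simp only [koszul, pairing_add_left, pairing_add_right]
    rw [mvfderiv_add (pairing_mdiff g hZ hX) (pairing_mdiff g hZ' hX),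
      mvfderiv_add (pairing_mdiff g hY hZ) (pairing_mdiff g hY hZ'),
      mlieBracket_add_left hZ hZ', mlieBracket_add_right hZ hZ']
    simp
    ring


instance (x : M) : FiniteDimensional ℝ (TangentSpace 𝓘(ℝ, E) x) :=
  inferInstanceAs (FiniteDimensional ℝ E)

instance (x : M) : T2Space (TangentSpace 𝓘(ℝ, E) x) :=
  inferInstanceAs (T2Space E)

/-- The musical isomorphism `v ↦ g(v, ·)`. -/
noncomputable def flat (g : Metric E M) (x : M) :
    TangentSpace 𝓘(ℝ, E) x ≃ₗ[ℝ] Module.Dual ℝ (TangentSpace 𝓘(ℝ, E) x) :=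
  LinearMap.linearEquivOfInjective
    ((ContinuousLinearMap.coeLM ℝ).comp (g.inner x).toLinearMap)
    (by
      rw [← LinearMap.ker_eq_bot, LinearMap.ker_eq_bot']
      intro v hv
      by_contra hne
      have h : g.inner x v v = 0 := congrArg (fun l => l v) hv
      exact (g.pos x v hne).ne' h)
    (Subspace.dual_finrank_eq).symm

theorem flat_apply (g : Metric E M) (x : M) (v w : TangentSpace 𝓘(ℝ, E) x) :
    flat g x v w = g.inner x v w := rfl

theorem inner_ext (g : Metric E M) (x : M) {v v' : TangentSpace 𝓘(ℝ, E) x}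
    (h : ∀ w, g.inner x v w = g.inner x v' w) : v = v' :=
  (flat g x).injective (LinearMap.ext h)

/-- The bilinear form `(v, w) ↦ 2 g(∇_v Y, w)` on `T_x M`. -/
noncomputable def koszulForm (g : Metric E M) {Y : Π x : M, TangentSpace 𝓘(ℝ, E) x} {x : M}
    (hY : MDiffAt (T% Y) x) :
    TangentSpace 𝓘(ℝ, E) x →L[ℝ] TangentSpace 𝓘(ℝ, E) x →L[ℝ] ℝ :=
  TensorialAt.mkHom₂ (fun X Z => koszul g X Y Z x) x
    (fun _ hZ => koszul_tensorial_left g hY hZ) (fun _ hX => koszul_tensorial_right g hX hY)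

open Classical in
/-- `lcFun g Y x v` is `∇_v Y` at `x`, the vector `u` with `2 g(u, w)` given by Koszul's formula
(and `0`, which is never used, where `Y` is not differentiable). -/
noncomputable def lcFun (g : Metric E M) (Y : Π x : M, TangentSpace 𝓘(ℝ, E) x) (x : M) :
    TangentSpace 𝓘(ℝ, E) x →L[ℝ] TangentSpace 𝓘(ℝ, E) x :=
  if hY : MDiffAt (T% Y) x then
    LinearMap.toContinuousLinearMap ((1 / 2 : ℝ) • (flat g x).symm.toLinearMap.comp
      ((ContinuousLinearMap.coeLM ℝ).comp (koszulForm g hY).toLinearMap))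
  else 0

theorem inner_lcFun (g : Metric E M) {X Y Z : Π x : M, TangentSpace 𝓘(ℝ, E) x} {x : M}
    (hX : MDiffAt (T% X) x) (hY : MDiffAt (T% Y) x) (hZ : MDiffAt (T% Z) x) :
    g.inner x (lcFun g Y x (X x)) (Z x) = koszul g X Y Z x / 2 := by
  have h : koszulForm g hY (X x) (Z x) = koszul g X Y Z x :=
    TensorialAt.mkHom₂_apply (fun _ hZ => koszul_tensorial_left g hY hZ)
      (fun _ hX => koszul_tensorial_right g hX hY) hX hZ
  rw [← h, ← flat_apply]
  simp [lcFun, dif_pos hY]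
  ring

theorem lcFun_isCovariantDerivative (g : Metric E M) :
    IsCovariantDerivativeOn (I := 𝓘(ℝ, E)) E (lcFun (E := E) (M := M) g) where
  add {Y Y' x} hY hY' _ := by
    ext v
    refine inner_ext g x fun w => ?_
    have e (u : TangentSpace 𝓘(ℝ, E) x) := FiberBundle.extend_apply_self E u
    have d (u : TangentSpace 𝓘(ℝ, E) x) :=
      FiberBundle.mdifferentiableAt_extend 𝓘(ℝ, E) E u
    have hs : MDiffAt (T% (Y + Y')) x := mdifferentiableAt_add_section hY hY'
    rw [← e v, ← e w, inner_lcFun g (d v) hs (d w)]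
    simp only [_root_.add_apply, map_add]
    rw [inner_lcFun g (d v) hY (d w), inner_lcFun g (d v) hY' (d w)]
    simp only [koszul, pairing_add_left, pairing_add_right]
    rw [mvfderiv_add (pairing_mdiff g hY (d w)) (pairing_mdiff g hY' (d w)),
      mvfderiv_add (pairing_mdiff g (d v) hY) (pairing_mdiff g (d v) hY'),
      mlieBracket_add_left hY hY', mlieBracket_add_right hY hY']
    simp
    ring
  leibniz {Y f x} hY hf _ := by
    ext v
    refine inner_ext g x fun w => ?_
    have e (u : TangentSpace 𝓘(ℝ, E) x) := FiberBundle.extend_apply_self E u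
    have d (u : TangentSpace 𝓘(ℝ, E) x) :=
      FiberBundle.mdifferentiableAt_extend 𝓘(ℝ, E) E u
    have hs : MDiffAt (T% (f • Y)) x := hf.smul_section hY
    rw [← e v, ← e w, inner_lcFun g (d v) hs (d w)]
    simp only [_root_.add_apply, map_add, _root_.smul_apply, map_smul]
    rw [inner_lcFun g (d v) hY (d w)]
    simp only [koszul, pairing_smul_left, pairing_smul_right]
    rw [mvfderiv_mul hf (pairing_mdiff g hY (d w)),
      mvfderiv_mul hf (pairing_mdiff g (d v) hY),
      mlieBracket_smul_left hf hY, mlieBracket_smul_right hf hY]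
    simp [pairing]
    rw [g.symm x v (Y x)]
    ring

/-- The Levi-Civita connection of `g`; `leviCivita g Y x v` is `∇_v Y` at `x`. -/
noncomputable def leviCivita (g : Metric E M) :
    CovariantDerivative 𝓘(ℝ, E) E (fun x : M => TangentSpace 𝓘(ℝ, E) x) :=
  ⟨lcFun g, lcFun_isCovariantDerivative g⟩

/-- The Levi-Civita connection is compatible with the metric. -/
theorem leviCivita_metric (g : Metric E M) {X Y Z : Π x : M, TangentSpace 𝓘(ℝ, E) x} {x : M}
    (hX : MDiffAt (T% X) x) (hY : MDiffAt (T% Y) x) (hZ : MDiffAt (T% Z) x) :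
    mvfderiv 𝓘(ℝ, E) (pairing g Y Z) x (X x) =
      g.inner x (leviCivita g Y x (X x)) (Z x) + g.inner x (Y x) (leviCivita g Z x (X x)) := by
  change _ = g.inner x (lcFun g Y x (X x)) (Z x) + g.inner x (Y x) (lcFun g Z x (X x))
  rw [g.symm x (Y x), inner_lcFun g hX hY hZ, inner_lcFun g hX hZ hY]
  simp only [koszul]
  rw [pairing_comm g Z X, pairing_comm g Z Y, pairing_comm g Y X,
    mlieBracket_swap_apply (V := Z) (W := Y), mlieBracket_swap_apply (V := Z) (W := X),
    mlieBracket_swap_apply (V := Y) (W := X)]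
  simp
  ring

/-- The Levi-Civita connection is torsion free. -/
theorem leviCivita_torsion_free (g : Metric E M) {X Y : Π x : M, TangentSpace 𝓘(ℝ, E) x} {x : M}
    (hX : MDiffAt (T% X) x) (hY : MDiffAt (T% Y) x) :
    leviCivita g Y x (X x) - leviCivita g X x (Y x) = mlieBracket 𝓘(ℝ, E) X Y x := by
  change lcFun g Y x (X x) - lcFun g X x (Y x) = _
  refine inner_ext g x fun w => ?_
  have e (u : TangentSpace 𝓘(ℝ, E) x) := FiberBundle.extend_apply_self E u
  have d (u : TangentSpace 𝓘(ℝ, E) x) :=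
    FiberBundle.mdifferentiableAt_extend 𝓘(ℝ, E) E u
  rw [← e w]
  simp only [map_sub, _root_.sub_apply]
  rw [inner_lcFun g hX hY (d w), inner_lcFun g hY hX (d w)]
  simp only [koszul]
  generalize FiberBundle.extend E w = Z
  rw [pairing_comm g Z X, pairing_comm g Z Y, pairing_comm g Y X,
    mlieBracket_swap_apply (V := Z) (W := Y), mlieBracket_swap_apply (V := Z) (W := X),
    mlieBracket_swap_apply (V := Y) (W := X)]
  simp
  ring

/-! ### Vector fields and Kähler structures -/

/-- `U` is open and `X` is a smooth vector field on `U` (its values off `U` are irrelevant). -/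
def IsSmoothFieldOn (U : Set M) (X : Π x : M, TangentSpace 𝓘(ℝ, E) x) : Prop :=
  IsOpen U ∧ ContMDiffOn 𝓘(ℝ, E) 𝓘(ℝ, E).tangent ∞
    (fun x => (⟨x, X x⟩ : TangentBundle 𝓘(ℝ, E) M)) U

/-- `(M, g, J)` is a Kähler manifold: `J` is a smooth almost complex structure which is
orthogonal with respect to `g` and parallel, `∇J = 0`. -/
structure IsKahler (g : Metric E M)
    (J : Π x : M, TangentSpace 𝓘(ℝ, E) x →L[ℝ] TangentSpace 𝓘(ℝ, E) x) : Prop where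
  smooth : ContMDiff 𝓘(ℝ, E) (𝓘(ℝ, E).prod 𝓘(ℝ, E →L[ℝ] E)) ∞
    (fun x => TotalSpace.mk' (E →L[ℝ] E)
      (E := fun x : M => TangentSpace 𝓘(ℝ, E) x →L[ℝ] TangentSpace 𝓘(ℝ, E) x) x (J x))
  sq : ∀ (x : M) (v : TangentSpace 𝓘(ℝ, E) x), J x (J x v) = -v
  orthogonal : ∀ (x : M) (v w : TangentSpace 𝓘(ℝ, E) x),
    g.inner x (J x v) (J x w) = g.inner x v w
  parallel : ∀ (U : Set M) (Y : Π x : M, TangentSpace 𝓘(ℝ, E) x), IsSmoothFieldOn U Y →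
    ∀ x ∈ U, ∀ v : TangentSpace 𝓘(ℝ, E) x,
      leviCivita g (fun y => J y (Y y)) x v = J x (leviCivita g Y x v)

/-! ### Foliations, given by their tangent distributions -/

/-- `X` is a smooth section over the open set `U` of the distribution `D`. -/
def IsSectionOn (D : Π x : M, Submodule ℝ (TangentSpace 𝓘(ℝ, E) x)) (U : Set M)
    (X : Π x : M, TangentSpace 𝓘(ℝ, E) x) : Prop :=
  IsSmoothFieldOn U X ∧ ∀ x ∈ U, X x ∈ D x

/-- The orthogonal distribution `D^⊥`. -/
def orth (g : Metric E M) (D : Π x : M, Submodule ℝ (TangentSpace 𝓘(ℝ, E) x)) (x : M) :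
    Submodule ℝ (TangentSpace 𝓘(ℝ, E) x) where
  carrier := {v | ∀ w ∈ D x, g.inner x v w = 0}
  add_mem' {a b} ha hb w hw := by simp [ha w hw, hb w hw]
  zero_mem' w _ := by simp
  smul_mem' c v hv w hw := by simp [hv w hw]

/-- `D` is the tangent distribution of a smooth foliation with leaves of real dimension `k`:
a smooth distribution of rank `k` (it has smooth local frames) which is involutive. -/
structure IsFoliation (k : ℕ) (D : Π x : M, Submodule ℝ (TangentSpace 𝓘(ℝ, E) x)) : Prop where
  exists_frame : ∀ x₀ : M, ∃ (U : Set M) (X : Fin k → Π x : M, TangentSpace 𝓘(ℝ, E) x),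
    IsOpen U ∧ x₀ ∈ U ∧ (∀ i, IsSmoothFieldOn U (X i)) ∧
    ∀ x ∈ U, LinearIndependent ℝ (fun i => X i x) ∧
      Submodule.span ℝ (Set.range fun i => X i x) = D x
  involutive : ∀ (U : Set M) (X Y : Π x : M, TangentSpace 𝓘(ℝ, E) x),
    IsSectionOn D U X → IsSectionOn D U Y → ∀ x ∈ U, mlieBracket 𝓘(ℝ, E) X Y x ∈ D x

/-- `D` is complex: `J D ⊆ D`. -/
def IsComplexDistribution (J : Π x : M, TangentSpace 𝓘(ℝ, E) x →L[ℝ] TangentSpace 𝓘(ℝ, E) x)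
    (D : Π x : M, Submodule ℝ (TangentSpace 𝓘(ℝ, E) x)) : Prop :=
  ∀ (x : M), ∀ v ∈ D x, J x v ∈ D x

/-- `D` is totally geodesic: the `D^⊥`-component of `∇_X X` vanishes for all sections `X` of `D`. -/
def IsTotallyGeodesic (g : Metric E M)
    (D : Π x : M, Submodule ℝ (TangentSpace 𝓘(ℝ, E) x)) : Prop :=
  ∀ (U : Set M) (X : Π x : M, TangentSpace 𝓘(ℝ, E) x), IsSectionOn D U X →
    ∀ x ∈ U, leviCivita g X x (X x) ∈ D x

/-- The Lie derivative `(L_V g)(X, Y) = V g(X, Y) - g([V, X], Y) - g(X, [V, Y])`. -/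
noncomputable def lieMetric (g : Metric E M) (V X Y : Π x : M, TangentSpace 𝓘(ℝ, E) x)
    (x : M) : ℝ :=
  mvfderiv 𝓘(ℝ, E) (pairing g X Y) x (V x)
    - g.inner x (mlieBracket 𝓘(ℝ, E) V X x) (Y x)
    - g.inner x (X x) (mlieBracket 𝓘(ℝ, E) V Y x)

/-- The Lie derivative `(L_V J) X = [V, J X] - J [V, X]`. -/
noncomputable def lieEndo (J : Π x : M, TangentSpace 𝓘(ℝ, E) x →L[ℝ] TangentSpace 𝓘(ℝ, E) x)
    (V X : Π x : M, TangentSpace 𝓘(ℝ, E) x) (x : M) : TangentSpace 𝓘(ℝ, E) x :=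
  mlieBracket 𝓘(ℝ, E) V (fun y => J y (X y)) x - J x (mlieBracket 𝓘(ℝ, E) V X x)

/-- The one-form `θ` is smooth. -/
def IsSmoothForm (θ : Π x : M, TangentSpace 𝓘(ℝ, E) x →L[ℝ] ℝ) : Prop :=
  ContMDiff 𝓘(ℝ, E) (𝓘(ℝ, E).prod 𝓘(ℝ, E →L[ℝ] ℝ)) ∞
    (fun x => TotalSpace.mk' (E →L[ℝ] ℝ)
      (E := fun x : M => TangentSpace 𝓘(ℝ, E) x →L[ℝ] Bundle.Trivial M ℝ x) x (θ x))

/-- The one-form `θ` is closed: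
`dθ(X, Y) = X(θ(Y)) - Y(θ(X)) - θ([X, Y])` vanishes for all local smooth fields `X`, `Y`. -/
def IsClosedForm (θ : Π x : M, TangentSpace 𝓘(ℝ, E) x →L[ℝ] ℝ) : Prop :=
  ∀ (U : Set M) (X Y : Π x : M, TangentSpace 𝓘(ℝ, E) x),
    IsSmoothFieldOn U X → IsSmoothFieldOn U Y → ∀ x ∈ U,
      mvfderiv 𝓘(ℝ, E) (fun y => θ y (Y y)) x (X x)
        - mvfderiv 𝓘(ℝ, E) (fun y => θ y (X y)) x (Y x)
        - θ x (mlieBracket 𝓘(ℝ, E) X Y x) = 0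

/-- The foliation with tangent distribution `D` is conformal with one-form `θ`: `θ` is smooth,
vanishes on `D^⊥`, and `L_V g = θ(V) g` on `D^⊥` for all sections `V` of `D`. -/
structure IsConformal (g : Metric E M) (D : Π x : M, Submodule ℝ (TangentSpace 𝓘(ℝ, E) x))
    (θ : Π x : M, TangentSpace 𝓘(ℝ, E) x →L[ℝ] ℝ) : Prop where
  smooth : IsSmoothForm θ
  vanishes : ∀ (x : M), ∀ v ∈ orth g D x, θ x v = 0
  lie : ∀ (U : Set M) (V X Y : Π x : M, TangentSpace 𝓘(ℝ, E) x),
    IsSectionOn D U V → IsSectionOn (orth g D) U X → IsSectionOn (orth g D) U Y →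
    ∀ x ∈ U, lieMetric g V X Y x = θ x (V x) * g.inner x (X x) (Y x)

/-- The foliation is homothetic with one-form `θ`: it is conformal and `dθ = 0`. -/
structure IsHomothetic (g : Metric E M) (D : Π x : M, Submodule ℝ (TangentSpace 𝓘(ℝ, E) x))
    (θ : Π x : M, TangentSpace 𝓘(ℝ, E) x →L[ℝ] ℝ) : Prop where
  conformal : IsConformal g D θ
  closed : IsClosedForm θ

/-- The foliation with tangent distribution `D` is holomorphic: `(L_V J)(TM) ⊆ D` for all
sections `V` of `D`. -/
def IsHolomorphicFoliation
    (J : Π x : M, TangentSpace 𝓘(ℝ, E) x →L[ℝ] TangentSpace 𝓘(ℝ, E) x)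
    (D : Π x : M, Submodule ℝ (TangentSpace 𝓘(ℝ, E) x)) : Prop :=
  ∀ (U : Set M) (V X : Π x : M, TangentSpace 𝓘(ℝ, E) x),
    IsSectionOn D U V → IsSmoothFieldOn U X → ∀ x ∈ U, lieEndo J V X x ∈ D x

end
end KahlerFoliation

open KahlerFoliation

/-!
Write `H` for the distribution orthogonal to the leaves. For a section `W` of `D`, the normal
component of `∇_X W`, for `X` in `H`, is an endomorphism of `H`; it is a `J`-linear one plus a
`J`-antilinear one `C_W`, and `C_{JW} = J C_W` because `J` is parallel. The foliation is holomorphic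
at a point exactly if `C` vanishes there (`IsHolomorphicAt`, `isHolomorphicFoliation`). The proof
shows that the norm of `C` is locally constant and that `C` vanishes where `θ` does not.

* Where `θ ≠ 0`: let `ζ` be the field dual to `θ`, a section of `D`. Closedness of `θ` on pairs of
  fields in `H` says that `g(∇_X ζ, Y)` is symmetric, and conformality then identifies it with
  `θ(ζ) g(X, Y) / 2`, which has no antilinear part. So `C_ζ = 0`, and `D` is spanned by `ζ` and `J ζ`
  (`isHolomorphicAt_of_ne_zero`).
* Hence `θ` vanishes on the open set where `C ≠ 0`. There the foliation is Riemannian, that is,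
  `c(W; X, Y) = g(∇_X W, Y)` is skew in `X`, `Y`, and `c` coincides with `C`. The curvature terms
  `g(R(A, X) W, Y)` are then expressed through the derivative of `c` (`pairing_curv_eq`). For `A`
  normal, the Bianchi identity and the invariance `R(J X, J Y) = R(X, Y)` force this derivative to
  vanish (`derivForm_eq_zero_of_normal`). For `A` tangent, pair symmetry makes it skew in `A` and `W`,
  which together with `c(J W; X, Y) = -c(W; X, J Y)` gives the same (`derivForm_self`,
  `derivForm_apply_self`). So `c` is parallel for the connections induced on `D` and `H`.
* Therefore `|C|²`, computed in orthonormal frames, has zero differential where `C ≠ 0`, and it also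
  does where `C = 0`, being minimal there (`mvfderiv_antiNormSq`). The set where `C = 0` is open and
  closed, and it is not empty if `θ` is not identically zero.

The curvature enters only as the field `R(X, Y) Z` for smooth fields on an open set; its symmetries
hold in this form, so its tensoriality is not needed.
-/

set_option linter.unusedSectionVars false

namespace KahlerFoliation

/-! ### Smooth functions and vector fields on open sets -/

section Calculus

variable {E : Type*} [NormedAddCommGroup E] [NormedSpace ℝ E]
  {M : Type*} [TopologicalSpace M] [ChartedSpace E M] [IsManifold 𝓘(ℝ, E) ∞ M]

/-- A smooth real function on the open set `U` (its values off `U` are irrelevant). -/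
def IsSmoothFunOn (U : Set M) (f : M → ℝ) : Prop :=
  ContMDiffOn 𝓘(ℝ, E) 𝓘(ℝ, ℝ) ∞ f U

/-- The derivative `X f` of a function along a vector field. -/
noncomputable def dirDeriv (f : M → ℝ) (X : Π x : M, TangentSpace 𝓘(ℝ, E) x) (x : M) : ℝ :=
  mvfderiv 𝓘(ℝ, E) f x (X x)

/-- The vector field `J X`. -/
noncomputable def applyField (J : Π x : M, TangentSpace 𝓘(ℝ, E) x →L[ℝ] TangentSpace 𝓘(ℝ, E) x)
    (X : Π x : M, TangentSpace 𝓘(ℝ, E) x) : Π x : M, TangentSpace 𝓘(ℝ, E) x :=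
  fun x => J x (X x)

variable {U : Set M} {f h : M → ℝ} {X Y Z W : Π x : M, TangentSpace 𝓘(ℝ, E) x} {x : M}

theorem IsSmoothFieldOn.mono {U' : Set M} (hX : IsSmoothFieldOn U X) (hU' : IsOpen U')
    (h : U' ⊆ U) : IsSmoothFieldOn U' X :=
  ⟨hU', hX.2.mono h⟩

theorem IsSmoothFieldOn.contMDiffAt (hX : IsSmoothFieldOn U X) (hx : x ∈ U) :
    CMDiffAt ∞ (T% X) x :=
  (hX.2 x hx).contMDiffAt (hX.1.mem_nhds hx)

theorem IsSmoothFieldOn.mdiffAt (hX : IsSmoothFieldOn U X) (hx : x ∈ U) : MDiffAt (T% X) x :=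
  (hX.contMDiffAt hx).mdifferentiableAt (by simp)

theorem IsSmoothFunOn.mdiffAt (hf : IsSmoothFunOn (E := E) U f) (hU : IsOpen U) (hx : x ∈ U) :
    MDiffAt f x :=
  ((hf x hx).contMDiffAt (hU.mem_nhds hx)).mdifferentiableAt (by simp)

theorem IsSmoothFieldOn.add (hX : IsSmoothFieldOn U X) (hY : IsSmoothFieldOn U Y) :
    IsSmoothFieldOn U (X + Y) :=
  ⟨hX.1, ContMDiffOn.add_section hX.2 hY.2⟩

theorem IsSmoothFieldOn.sub (hX : IsSmoothFieldOn U X) (hY : IsSmoothFieldOn U Y) :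
    IsSmoothFieldOn U (X - Y) :=
  ⟨hX.1, ContMDiffOn.sub_section hX.2 hY.2⟩

theorem IsSmoothFieldOn.neg (hX : IsSmoothFieldOn U X) : IsSmoothFieldOn U (-X) :=
  ⟨hX.1, ContMDiffOn.neg_section hX.2⟩

theorem IsSmoothFieldOn.smul (hf : IsSmoothFunOn (E := E) U f) (hX : IsSmoothFieldOn U X) :
    IsSmoothFieldOn U (f • X) :=
  ⟨hX.1, ContMDiffOn.smul_section hf hX.2⟩

theorem IsSmoothFieldOn.sum {ι : Type*} [Fintype ι] (hU : IsOpen U)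
    {X : ι → Π x : M, TangentSpace 𝓘(ℝ, E) x}
    (hX : ∀ i, IsSmoothFieldOn U (X i)) : IsSmoothFieldOn U (fun y => ∑ i, X i y) :=
  ⟨hU, ContMDiffOn.sum_section fun i _ => (hX i).2⟩

theorem IsSmoothFieldOn.congr (hX : IsSmoothFieldOn U X) (h : ∀ y ∈ U, Y y = X y) :
    IsSmoothFieldOn U Y :=
  ⟨hX.1, hX.2.congr fun y hy => by simp [h y hy]⟩

theorem IsSmoothFunOn.mono {U' : Set M} (hf : IsSmoothFunOn (E := E) U f)
    (h : U' ⊆ U) : IsSmoothFunOn (E := E) U' f :=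
  ContMDiffOn.mono hf h

theorem isSmoothFunOn_const (c : ℝ) : IsSmoothFunOn (E := E) U (fun _ => c) :=
  contMDiffOn_const

theorem IsSmoothFunOn.add (hf : IsSmoothFunOn (E := E) U f) (hh : IsSmoothFunOn (E := E) U h) :
    IsSmoothFunOn (E := E) U (f + h) :=
  ContMDiffOn.add hf hh

theorem IsSmoothFunOn.sub (hf : IsSmoothFunOn (E := E) U f) (hh : IsSmoothFunOn (E := E) U h) :
    IsSmoothFunOn (E := E) U (f - h) :=
  ContMDiffOn.sub hf hh

theorem IsSmoothFunOn.mul (hf : IsSmoothFunOn (E := E) U f) (hh : IsSmoothFunOn (E := E) U h) :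
    IsSmoothFunOn (E := E) U (f * h) :=
  ContMDiffOn.mul hf hh

theorem IsSmoothFunOn.comp (φ : ℝ → ℝ) (hf : IsSmoothFunOn (E := E) U f)
    (hφ : ∀ y ∈ U, ContDiffAt ℝ ∞ φ (f y)) : IsSmoothFunOn (E := E) U (fun y => φ (f y)) :=
  fun y hy => ((hφ y hy).contMDiffAt).comp_contMDiffWithinAt y (hf y hy)

theorem isSmoothFunOn_pairing (g : Metric E M) (hX : IsSmoothFieldOn U X)
    (hY : IsSmoothFieldOn U Y) : IsSmoothFunOn (E := E) U (pairing g X Y) := by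
  intro x hx
  have h := ContMDiffAt.clm_bundle_apply₂ (F₁ := E) (F₂ := E) (F₃ := ℝ)
     (E₁ := fun x : M => TangentSpace 𝓘(ℝ, E) x) (E₂ := fun x : M => TangentSpace 𝓘(ℝ, E) x)
     (E₃ := Bundle.Trivial M ℝ)
    (g.contMDiff.contMDiffAt (x := x)) (hX.contMDiffAt hx) (hY.contMDiffAt hx)
  simp only [contMDiffAt_totalSpace] at h
  exact h.2.contMDiffWithinAt

theorem isSmoothFunOn_form {θ : Π x : M, TangentSpace 𝓘(ℝ, E) x →L[ℝ] ℝ} (hθ : IsSmoothForm θ)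
    (hX : IsSmoothFieldOn U X) : IsSmoothFunOn (E := E) U (fun y => θ y (X y)) := by
  intro x hx
  have h := ContMDiffAt.clm_bundle_apply (F₁ := E) (F₂ := ℝ)
     (E₁ := fun x : M => TangentSpace 𝓘(ℝ, E) x)
     (E₂ := Bundle.Trivial M ℝ)
    (hθ.contMDiffAt (x := x)) (hX.contMDiffAt hx)
  simp only [contMDiffAt_totalSpace] at h
  exact h.2.contMDiffWithinAt

theorem dirDeriv_congr {f₁ f₂ : M → ℝ} (hU : IsOpen U) (hx : x ∈ U) (h : ∀ y ∈ U, f₁ y = f₂ y) :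
    dirDeriv f₁ X x = dirDeriv f₂ X x := by
  have : f₁ =ᶠ[nhds x] f₂ := by
    filter_upwards [hU.mem_nhds hx] with y hy using h y hy
  simp only [dirDeriv, mvfderiv, this.mfderiv_eq]
  rfl

theorem isSmoothFunOn_dirDeriv (hf : IsSmoothFunOn (E := E) U f)
    (hX : IsSmoothFieldOn U X) : IsSmoothFunOn (E := E) U (dirDeriv f X) := by
  intro x hx
  have : IsManifold 𝓘(ℝ, E) 1 M := IsManifold.of_le (n := ∞) (by simp)
  have h1 := ContMDiffOn.contMDiffOn_tangentMapWithin (m := ∞) hf (by simp) hX.1.uniqueMDiffOn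
  have h2 := (h1.comp hX.2 (fun y hy => hy)) x hx
  rw [Function.comp_def, contMDiffWithinAt_totalSpace] at h2
  refine (h2.2.congr (fun y hy => ?_) ?_)
  · simp [dirDeriv, tangentMapWithin, mfderivWithin_of_isOpen hX.1 hy, mvfderiv]
    rfl
  · simp [dirDeriv, tangentMapWithin, mfderivWithin_of_isOpen hX.1 hx, mvfderiv]
    rfl

theorem dirDeriv_mul (hf : MDiffAt f x) (hh : MDiffAt h x) :
    dirDeriv (f * h) X x = f x * dirDeriv h X x + h x * dirDeriv f X x := by
  simp [dirDeriv, mvfderiv_mul hf hh]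

theorem dirDeriv_add (hf : MDiffAt f x) (hh : MDiffAt h x) :
    dirDeriv (f + h) X x = dirDeriv f X x + dirDeriv h X x := by
  simp [dirDeriv, mvfderiv_add hf hh]

theorem dirDeriv_const (c : ℝ) : dirDeriv (fun _ : M => c) X x = 0 := by
  simp [dirDeriv, mvfderiv_const]

theorem IsSmoothFieldOn.applyField
    {J : Π x : M, TangentSpace 𝓘(ℝ, E) x →L[ℝ] TangentSpace 𝓘(ℝ, E) x}
    (hJ : ContMDiff 𝓘(ℝ, E) (𝓘(ℝ, E).prod 𝓘(ℝ, E →L[ℝ] E)) ∞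
    (fun x => TotalSpace.mk' (E →L[ℝ] E)
      (E := fun x : M => TangentSpace 𝓘(ℝ, E) x →L[ℝ] TangentSpace 𝓘(ℝ, E) x) x (J x)))
    (hX : IsSmoothFieldOn U X) : IsSmoothFieldOn U (applyField J X) :=
  ⟨hX.1, ContMDiffOn.clm_bundle_apply (F₁ := E) (F₂ := E)
     (E₁ := fun x : M => TangentSpace 𝓘(ℝ, E) x) (E₂ := fun x : M => TangentSpace 𝓘(ℝ, E) x)
     hJ.contMDiffOn hX.2⟩

theorem IsSmoothFieldOn.mlieBracket [CompleteSpace E] (hX : IsSmoothFieldOn U X)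
    (hY : IsSmoothFieldOn U Y) :
    IsSmoothFieldOn U (mlieBracket 𝓘(ℝ, E) X Y) := by
  have : IsManifold 𝓘(ℝ, E) (((⊤ : ℕ∞) : WithTop ℕ∞) + 1) M := by simpa
  have : IsManifold 𝓘(ℝ, E) (minSmoothness ℝ 2) M := by
    simpa using IsManifold.of_le (n := ∞) (m := 2)
      ENat.LEInfty.out
  exact ⟨hX.1, fun x hx => (ContMDiffAt.mlieBracket_vectorField (m := ⊤) (n := ⊤)
    (hX.contMDiffAt hx) (hY.contMDiffAt hx) (by simp)).contMDiffWithinAt⟩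

/-- Any tangent vector extends to a field smooth near its base point. -/
theorem exists_smooth_extension (x : M) (v : TangentSpace 𝓘(ℝ, E) x) :
    ∃ (U : Set M) (X : Π x : M, TangentSpace 𝓘(ℝ, E) x), x ∈ U ∧ IsSmoothFieldOn U X ∧ X x = v := by
  let e := trivializationAt E (fun y : M => TangentSpace 𝓘(ℝ, E) y) x
  have hx : x ∈ e.baseSet := FiberBundle.mem_baseSet_trivializationAt' x
  refine ⟨e.baseSet, fun y => e.symm y (e ⟨x, v⟩).2, hx, ⟨e.open_baseSet, ?_⟩, ?_⟩
  · refine (e.contMDiffOn_section_baseSet_iff (IB := 𝓘(ℝ, E)) (n := ∞)).2 ?_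
    refine (contMDiffOn_const (c := (e ⟨x, v⟩).2)).congr fun y hy => ?_
    rw [e.apply_mk_symm hy]
  · exact e.symm_apply_apply_mk hx v

/-- The Lie bracket acts on functions as the commutator: `[X, Y] f = X (Y f) - Y (X f)`. It follows
from the Jacobi identity for `X`, `Y`, `f • Z`, where `Z` is any field not vanishing at `x`. -/
theorem dirDeriv_mlieBracket [CompleteSpace E] (hX : IsSmoothFieldOn U X) (hY : IsSmoothFieldOn U Y)
    (hf : IsSmoothFunOn (E := E) U f) (hx : x ∈ U) :
    dirDeriv f (mlieBracket 𝓘(ℝ, E) X Y) x =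
      dirDeriv (dirDeriv f Y) X x - dirDeriv (dirDeriv f X) Y x := by
  by_cases hE : ∃ v : TangentSpace 𝓘(ℝ, E) x, v ≠ 0
  · obtain ⟨v, hv⟩ := hE
    obtain ⟨U', Z, hx', hZ, rfl⟩ := exists_smooth_extension x v
    have hO : IsOpen (U ∩ U') := hX.1.inter hZ.1
    have hxO : x ∈ U ∩ U' := ⟨hx, hx'⟩
    replace hX := hX.mono hO Set.inter_subset_left
    replace hY := hY.mono hO Set.inter_subset_left
    replace hZ := hZ.mono hO Set.inter_subset_right
    replace hf := hf.mono (U' := U ∩ U') Set.inter_subset_left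
    have h2 : (minSmoothness ℝ 2) ≤ (∞ : WithTop ℕ∞) := by
      simpa using ENat.LEInfty.out
    have : IsManifold 𝓘(ℝ, E) (minSmoothness ℝ 3) M := by
      simpa using IsManifold.of_le (n := ∞) (m := 3)
        ENat.LEInfty.out
    have key (A B : Π x : M, TangentSpace 𝓘(ℝ, E) x) (hA : IsSmoothFieldOn (U ∩ U') A)
        (hB : IsSmoothFieldOn (U ∩ U') B) :
        mlieBracket 𝓘(ℝ, E) A (mlieBracket 𝓘(ℝ, E) B (f • Z)) x =
          dirDeriv (dirDeriv f B) A x • Z x + dirDeriv f B x • mlieBracket 𝓘(ℝ, E) A Z x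
          + (dirDeriv f A x • mlieBracket 𝓘(ℝ, E) B Z x
            + f x • mlieBracket 𝓘(ℝ, E) A (mlieBracket 𝓘(ℝ, E) B Z) x) := by
      have e : mlieBracket 𝓘(ℝ, E) B (f • Z) =ᶠ[nhds x]
          dirDeriv f B • Z + f • mlieBracket 𝓘(ℝ, E) B Z := by
        filter_upwards [hO.mem_nhds hxO] with y hy
        rw [mlieBracket_smul_right (hf.mdiffAt hO hy) (hZ.mdiffAt hy)]
        rfl
      have hd := isSmoothFunOn_dirDeriv hf hB
      have hBZ := hB.mlieBracket hZ
      rw [Filter.EventuallyEq.mlieBracket_vectorField_eq (Filter.EventuallyEq.refl _ A) e,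
        mlieBracket_add_right ((hZ.smul hd).mdiffAt hxO) ((hBZ.smul hf).mdiffAt hxO),
        mlieBracket_smul_right (hd.mdiffAt hO hxO) (hZ.mdiffAt hxO),
        mlieBracket_smul_right (hf.mdiffAt hO hxO) (hBZ.mdiffAt hxO)]
      rfl
    have j1 := leibniz_identity_mlieBracket_apply ((hX.contMDiffAt hxO).of_le h2)
      ((hY.contMDiffAt hxO).of_le h2) (((hZ.smul hf).contMDiffAt hxO).of_le h2)
    have j2 := leibniz_identity_mlieBracket_apply ((hX.contMDiffAt hxO).of_le h2)
      ((hY.contMDiffAt hxO).of_le h2) ((hZ.contMDiffAt hxO).of_le h2)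
    rw [key X Y hX hY, key Y X hY hX,
      mlieBracket_smul_right (hf.mdiffAt hO hxO) (hZ.mdiffAt hxO), j2] at j1
    have j3 : (dirDeriv f (mlieBracket 𝓘(ℝ, E) X Y) x -
      (dirDeriv (dirDeriv f Y) X x - dirDeriv (dirDeriv f X) Y x)) • Z x = 0 := by
      have : mvfderiv 𝓘(ℝ, E) f x (mlieBracket 𝓘(ℝ, E) X Y x) =
        dirDeriv f (mlieBracket 𝓘(ℝ, E) X Y) x := rfl
      rw [this] at j1
      rw [← neg_eq_zero, ← sub_eq_zero.2 j1]
      module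
    rcases smul_eq_zero.1 j3 with h | h
    · linarith
    · exact absurd h hv
  · push Not at hE
    simp only [dirDeriv]
    rw [hE (X x), hE (Y x), hE (mlieBracket _ _ _ _)]
    simp

end Calculus

end KahlerFoliation

namespace KahlerFoliation

/-! ### Orthonormal frames and the Levi-Civita connection -/

section LeviCivita

variable {E : Type*} [NormedAddCommGroup E] [NormedSpace ℝ E] [FiniteDimensional ℝ E]
  {M : Type*} [TopologicalSpace M] [ChartedSpace E M] [IsManifold 𝓘(ℝ, E) ∞ M]

/-- The fields `e i` are smooth on `U` and orthonormal at each of its points. -/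
def IsOrthonormalOn (g : Metric E M) (U : Set M) {k : ℕ}
    (e : Fin k → Π x : M, TangentSpace 𝓘(ℝ, E) x) : Prop :=
  (∀ i, IsSmoothFieldOn U (e i)) ∧
    ∀ y ∈ U, ∀ i j, g.inner y (e i y) (e j y) = if i = j then 1 else 0

/-- The covariant derivative `∇_X Y` as a vector field. -/
noncomputable def covDeriv (g : Metric E M) (X Y : Π x : M, TangentSpace 𝓘(ℝ, E) x) :
    Π x : M, TangentSpace 𝓘(ℝ, E) x :=
  fun x => leviCivita g Y x (X x)

/-- The curvature field `R(X, Y) Z = ∇_X ∇_Y Z - ∇_Y ∇_X Z - ∇_{[X, Y]} Z`. -/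
noncomputable def curv (g : Metric E M) (X Y Z : Π x : M, TangentSpace 𝓘(ℝ, E) x) :
    Π x : M, TangentSpace 𝓘(ℝ, E) x :=
  covDeriv g X (covDeriv g Y Z) - covDeriv g Y (covDeriv g X Z)
    - covDeriv g (mlieBracket 𝓘(ℝ, E) X Y) Z

variable {g : Metric E M} {U : Set M} {f h : M → ℝ}
  {X Y Z W : Π x : M, TangentSpace 𝓘(ℝ, E) x} {x : M}

theorem isOpen_inter_ne_zero (hU : IsOpen U) (hf : IsSmoothFunOn (E := E) U f) :
    IsOpen {y ∈ U | f y ≠ 0} :=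
  (ContMDiffOn.continuousOn hf).isOpen_inter_preimage hU isOpen_ne

theorem isOpen_inter_pos (hU : IsOpen U) (hf : IsSmoothFunOn (E := E) U f) :
    IsOpen {y ∈ U | 0 < f y} :=
  (ContMDiffOn.continuousOn hf).isOpen_inter_preimage hU isOpen_Ioi

theorem IsOrthonormalOn.mono {k : ℕ} {e : Fin k → Π x : M, TangentSpace 𝓘(ℝ, E) x}
    (he : IsOrthonormalOn g U e) {U' : Set M} (hU' : IsOpen U') (h : U' ⊆ U) :
    IsOrthonormalOn g U' e :=
  ⟨fun i => (he.1 i).mono hU' h, fun y hy => he.2 y (h hy)⟩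

/-- One step of the Gram-Schmidt process. -/
theorem IsOrthonormalOn.exists_snoc {k : ℕ} {e : Fin k → Π x : M, TangentSpace 𝓘(ℝ, E) x}
    (he : IsOrthonormalOn g U e) (hU : IsOpen U) (hx : x ∈ U) (hk : k < Module.finrank ℝ E) :
    ∃ (U' : Set M) (Z : Π x : M, TangentSpace 𝓘(ℝ, E) x), IsOpen U' ∧ x ∈ U' ∧ U' ⊆ U ∧
      IsOrthonormalOn g U' (Fin.snoc (α := fun _ => Π x : M, TangentSpace 𝓘(ℝ, E) x) e Z) := by
  let L : TangentSpace 𝓘(ℝ, E) x →ₗ[ℝ] (Fin k → ℝ) :=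
    LinearMap.pi fun i => (g.inner x (e i x)).toLinearMap
  have hker : LinearMap.ker L ≠ ⊥ := LinearMap.ker_ne_bot_of_finrank_lt (by
    have : Module.finrank ℝ (TangentSpace 𝓘(ℝ, E) x) = Module.finrank ℝ E := rfl
    simpa [this] using hk)
  obtain ⟨v, hv, hv0⟩ := (Submodule.ne_bot_iff _).1 hker
  have hv' (i) : g.inner x (e i x) v = 0 := congrFun (LinearMap.mem_ker.1 hv) i
  obtain ⟨U₁, Z, hx₁, hZ, rfl⟩ := exists_smooth_extension x v
  have hO : IsOpen (U ∩ U₁) := hU.inter hZ.1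
  have he' := he.mono hO Set.inter_subset_left
  replace hZ := hZ.mono hO Set.inter_subset_right
  set Z' : Π x : M, TangentSpace 𝓘(ℝ, E) x :=
    Z - fun y => ∑ i, pairing g (e i) Z y • e i y with hZ'
  have hZs : IsSmoothFieldOn (U ∩ U₁) Z' := hZ.sub (IsSmoothFieldOn.sum hO fun i =>
    IsSmoothFieldOn.smul (isSmoothFunOn_pairing g (he'.1 i) hZ) (he'.1 i))
  have horth (y) (hy : y ∈ U ∩ U₁) (i) : g.inner y (e i y) (Z' y) = 0 := by
    simp [hZ', map_sum, he'.2 y hy, pairing]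
  have hq := isSmoothFunOn_pairing g hZs hZs
  have hZ'x : Z' x = Z x := by
    simp [hZ', pairing, hv']
  have hO' := isOpen_inter_pos hO hq
  have hsub : {y ∈ U ∩ U₁ | 0 < pairing g Z' Z' y} ⊆ U ∩ U₁ := fun y hy => hy.1
  refine ⟨_, (fun y => (√(pairing g Z' Z' y))⁻¹) • Z', hO', ⟨⟨hx, hx₁⟩, ?_⟩,
    fun y hy => hy.1.1, ?_, ?_⟩
  · rw [pairing, hZ'x]
    exact g.pos x _ hv0
  · intro i
    refine Fin.lastCases ?_ (fun i => ?_) i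
    · simp only [Fin.snoc_last]
      refine (hZs.mono hO' hsub).smul ((hq.mono hsub).comp (fun t => (√t)⁻¹) fun y hy => ?_)
      exact (Real.contDiffAt_sqrt hy.2.ne').inv (Real.sqrt_ne_zero'.2 hy.2)
    · simp only [Fin.snoc_castSucc]
      exact (he'.1 i).mono hO' hsub
  · intro y hy i j
    have hp : g.inner y (Z' y) (Z' y) = √(pairing g Z' Z' y) * √(pairing g Z' Z' y) :=
      (Real.mul_self_sqrt hy.2.le).symm
    have hs := (Real.sqrt_ne_zero'.2 hy.2)
    have h1 := fun i => horth y (hsub hy) i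
    have h2 := fun i => (g.symm y _ _).trans (horth y (hsub hy) i)
    refine Fin.lastCases ?_ (fun i => ?_) i <;> refine Fin.lastCases ?_ (fun j => ?_) j
    · simp [hp]
      field_simp
    · simp [h2, (Fin.castSucc_lt_last j).ne']
    · simp [h1, (Fin.castSucc_lt_last i).ne]
    · simp [he'.2 y (hsub hy)]

/-- An orthonormal family of fields can be completed to a longer one, near any point. -/
theorem IsOrthonormalOn.exists_append {k : ℕ} {e : Fin k → Π x : M, TangentSpace 𝓘(ℝ, E) x}
    (he : IsOrthonormalOn g U e) (hU : IsOpen U) (hx : x ∈ U) (m : ℕ)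
    (hm : k + m ≤ Module.finrank ℝ E) :
    ∃ (U' : Set M) (t : Fin (k + m) → Π x : M, TangentSpace 𝓘(ℝ, E) x), IsOpen U' ∧ x ∈ U' ∧
      U' ⊆ U ∧ IsOrthonormalOn g U' t ∧ ∀ i, t (Fin.castAdd m i) = e i := by
  induction m with
  | zero => exact ⟨U, e, hU, hx, subset_rfl, he, fun i => rfl⟩
  | succ m ih =>
    obtain ⟨U', t, hU', hx', hsub, ht, hte⟩ := ih (by omega)
    obtain ⟨U'', Z, hU'', hx'', hsub', ht'⟩ := ht.exists_snoc hU' hx' (by omega)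
    refine ⟨U'', _, hU'', hx'', hsub'.trans hsub, ht', fun i => ?_⟩
    rw [← hte i]
    exact Fin.snoc_castSucc (α := fun _ => Π x : M, TangentSpace 𝓘(ℝ, E) x) Z t (Fin.castAdd m i)

theorem IsOrthonormalOn.sum_eq {k : ℕ} {e : Fin k → Π x : M, TangentSpace 𝓘(ℝ, E) x}
    (he : IsOrthonormalOn g U e) (hx : x ∈ U) (hk : k = Module.finrank ℝ E)
    (v : TangentSpace 𝓘(ℝ, E) x) : ∑ i, g.inner x v (e i x) • e i x = v := by
  let L : TangentSpace 𝓘(ℝ, E) x →ₗ[ℝ] (Fin k → ℝ) :=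
    LinearMap.pi fun i => (g.inner x (e i x)).toLinearMap
  have hL (c : Fin k → ℝ) : L (∑ i, c i • e i x) = c := by
    ext j
    simp [L, map_sum, he.2 x hx]
  have hfin : Module.finrank ℝ (TangentSpace 𝓘(ℝ, E) x) = Module.finrank ℝ (Fin k → ℝ) := by
    have : Module.finrank ℝ (TangentSpace 𝓘(ℝ, E) x) = Module.finrank ℝ E := rfl
    simpa [this] using hk.symm
  have hinj : Function.Injective L :=
    (LinearMap.injective_iff_surjective_of_finrank_eq_finrank hfin).2 fun c => ⟨_, hL c⟩
  refine hinj ((hL _).trans ?_)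
  ext j
  exact g.symm x _ _

theorem isSmoothFunOn_koszul (hX : IsSmoothFieldOn U X) (hY : IsSmoothFieldOn U Y)
    (hZ : IsSmoothFieldOn U Z) : IsSmoothFunOn (E := E) U (koszul g X Y Z) := by
  have hp {A B : Π x : M, TangentSpace 𝓘(ℝ, E) x} (hA : IsSmoothFieldOn U A)
    (hB : IsSmoothFieldOn U B) := isSmoothFunOn_pairing g hA hB
  exact (((((isSmoothFunOn_dirDeriv (hp hY hZ) hX).add (isSmoothFunOn_dirDeriv (hp hZ hX) hY)).sub
    (isSmoothFunOn_dirDeriv (hp hX hY) hZ)).add (hp (hX.mlieBracket hY) hZ)).sub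
    (hp (hY.mlieBracket hZ) hX)).add (hp (hZ.mlieBracket hX) hY)

/-- The Levi-Civita connection preserves smoothness: in a smooth orthonormal frame, the coefficients
of `∇_X Y` are given by Koszul's expression. -/
theorem IsSmoothFieldOn.covDeriv (hX : IsSmoothFieldOn U X) (hY : IsSmoothFieldOn U Y) :
    IsSmoothFieldOn U (covDeriv g X Y) := by
  refine ⟨hX.1, fun x hx => ?_⟩
  have h0 : IsOrthonormalOn g U (Fin.elim0 : Fin 0 → Π x : M, TangentSpace 𝓘(ℝ, E) x) :=
    ⟨fun i => i.elim0, fun _ _ i => i.elim0⟩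
  obtain ⟨U', t, hU', hx', hsub, ht, -⟩ := h0.exists_append hX.1 hx (Module.finrank ℝ E) (by simp)
  have hX' := hX.mono hU' hsub
  have hY' := hY.mono hU' hsub
  have hs : IsSmoothFieldOn U'
      (fun y => ∑ i, (((fun _ => (1 / 2 : ℝ)) * koszul g X Y (t i) : M → ℝ) • t i) y) :=
    IsSmoothFieldOn.sum hU' fun i => IsSmoothFieldOn.smul
      ((isSmoothFunOn_const _).mul (isSmoothFunOn_koszul hX' hY' (ht.1 i))) (ht.1 i)
  have hs' : IsSmoothFieldOn U' (KahlerFoliation.covDeriv g X Y) := hs.congr fun y hy => by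
    rw [← ht.sum_eq hy (by simp) (KahlerFoliation.covDeriv g X Y y)]
    refine Finset.sum_congr rfl fun i _ => ?_
    refine congrArg (· • t i y) ?_
    refine (inner_lcFun g (hX'.mdiffAt hy) (hY'.mdiffAt hy) ((ht.1 i).mdiffAt hy)).trans ?_
    simp
    ring
  exact (hs'.contMDiffAt hx').contMDiffWithinAt

theorem covDeriv_congr (hU : IsOpen U) (hx : x ∈ U) (hY : IsSmoothFieldOn U Y)
    (h : ∀ y ∈ U, Y y = Z y) : covDeriv g X Y x = covDeriv g X Z x := by
  have e : Y =ᶠ[nhds x] Z := by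
    filter_upwards [hU.mem_nhds hx] with y hy using h y hy
  have hZ : IsSmoothFieldOn U Z := hY.congr fun y hy => (h y hy).symm
  have := (lcFun_isCovariantDerivative g).congr_of_eventuallyEq (hY.mdiffAt hx) (hZ.mdiffAt hx)
    Filter.univ_mem e
  exact congrArg (fun l => l (X x)) this

theorem dirDeriv_pairing (hX : IsSmoothFieldOn U X) (hY : IsSmoothFieldOn U Y)
    (hZ : IsSmoothFieldOn U Z) (hx : x ∈ U) :
    dirDeriv (pairing g Y Z) X x =
      pairing g (covDeriv g X Y) Z x + pairing g Y (covDeriv g X Z) x :=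
  leviCivita_metric g (hX.mdiffAt hx) (hY.mdiffAt hx) (hZ.mdiffAt hx)

theorem covDeriv_sub_covDeriv (hX : IsSmoothFieldOn U X) (hY : IsSmoothFieldOn U Y) (hx : x ∈ U) :
    covDeriv g X Y x - covDeriv g Y X x = mlieBracket 𝓘(ℝ, E) X Y x :=
  leviCivita_torsion_free g (hX.mdiffAt hx) (hY.mdiffAt hx)

theorem covDeriv_add_right (hY : IsSmoothFieldOn U Y) (hZ : IsSmoothFieldOn U Z) (hx : x ∈ U) :
    covDeriv g X (Y + Z) x = covDeriv g X Y x + covDeriv g X Z x :=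
  congrArg (fun l => l (X x))
    ((lcFun_isCovariantDerivative g).add (hY.mdiffAt hx) (hZ.mdiffAt hx) (Set.mem_univ x))

theorem covDeriv_smul_right (hf : IsSmoothFunOn (E := E) U f) (hY : IsSmoothFieldOn U Y)
    (hx : x ∈ U) :
    covDeriv g X (f • Y) x = f x • covDeriv g X Y x + dirDeriv f X x • Y x :=
  congrArg (fun l => l (X x))
    ((lcFun_isCovariantDerivative g).leibniz (hY.mdiffAt hx) (hf.mdiffAt hY.1 hx) (Set.mem_univ x))

theorem covDeriv_neg_right (hY : IsSmoothFieldOn U Y) (hx : x ∈ U) :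
    covDeriv g X (-Y) x = -covDeriv g X Y x := by
  have h : -Y = (fun _ : M => (-1 : ℝ)) • Y := by ext y; simp
  rw [h, covDeriv_smul_right (isSmoothFunOn_const (-1)) hY hx, dirDeriv_const]
  simp

theorem covDeriv_sub_right (hY : IsSmoothFieldOn U Y) (hZ : IsSmoothFieldOn U Z) (hx : x ∈ U) :
    covDeriv g X (Y - Z) x = covDeriv g X Y x - covDeriv g X Z x := by
  rw [sub_eq_add_neg, covDeriv_add_right hY hZ.neg hx, covDeriv_neg_right hZ hx, ← sub_eq_add_neg]

/-! ### Symmetries of the curvature tensor -/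

theorem pairing_curv_skew (hX : IsSmoothFieldOn U X) (hY : IsSmoothFieldOn U Y)
    (hZ : IsSmoothFieldOn U Z) (hW : IsSmoothFieldOn U W) (hx : x ∈ U) :
    pairing g (curv g X Y Z) W x = -pairing g (curv g X Y W) Z x := by
  have key (A B : Π x : M, TangentSpace 𝓘(ℝ, E) x) (hA : IsSmoothFieldOn U A)
      (hB : IsSmoothFieldOn U B) : dirDeriv (dirDeriv (pairing g Z W) B) A x =
      pairing g (covDeriv g A (covDeriv g B Z)) W x + pairing g (covDeriv g B Z) (covDeriv g A W) x
      + (pairing g (covDeriv g A Z) (covDeriv g B W) x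
        + pairing g Z (covDeriv g A (covDeriv g B W)) x) := by
    rw [dirDeriv_congr hA.1 hx (f₂ := pairing g (covDeriv g B Z) W + pairing g Z (covDeriv g B W))
      fun y hy => dirDeriv_pairing hB hZ hW hy, dirDeriv_add, dirDeriv_pairing hA _ hW hx,
      dirDeriv_pairing hA hZ _ hx]
    · exact hB.covDeriv hW
    · exact hB.covDeriv hZ
    · exact (isSmoothFunOn_pairing g (hB.covDeriv hZ) hW).mdiffAt hA.1 hx
    · exact (isSmoothFunOn_pairing g hZ (hB.covDeriv hW)).mdiffAt hA.1 hx
  have h := dirDeriv_mlieBracket hX hY (isSmoothFunOn_pairing g hZ hW) hx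
  rw [key X Y hX hY, key Y X hY hX, dirDeriv_pairing (hX.mlieBracket hY) hZ hW hx] at h
  simp only [curv, pairing, Pi.sub_apply, map_sub, sub_apply] at h ⊢
  simp only [g.symm x (Z x)] at h
  linarith

theorem curv_swap : curv g X Y Z x = -curv g Y X Z x := by
  simp only [curv, Pi.sub_apply]
  have : covDeriv g (mlieBracket 𝓘(ℝ, E) Y X) Z x = -covDeriv g (mlieBracket 𝓘(ℝ, E) X Y) Z x := by
    simp only [covDeriv]
    rw [mlieBracket_swap_apply, map_neg]
  rw [this]
  abel

theorem curv_bianchi (hX : IsSmoothFieldOn U X) (hY : IsSmoothFieldOn U Y)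
    (hZ : IsSmoothFieldOn U Z) (hx : x ∈ U) :
    curv g X Y Z x + curv g Y Z X x + curv g Z X Y x = 0 := by
  have key (A B C : Π x : M, TangentSpace 𝓘(ℝ, E) x) (hA : IsSmoothFieldOn U A)
      (hB : IsSmoothFieldOn U B) (hC : IsSmoothFieldOn U C) :
      covDeriv g A (covDeriv g B C) x - covDeriv g A (covDeriv g C B) x
        - covDeriv g (mlieBracket 𝓘(ℝ, E) B C) A x
      = mlieBracket 𝓘(ℝ, E) A (mlieBracket 𝓘(ℝ, E) B C) x := by
    rw [← covDeriv_sub_covDeriv (g := g) hA (hB.mlieBracket hC) hx,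
      ← covDeriv_sub_right (hB.covDeriv hC) (hC.covDeriv hB) hx]
    rw [covDeriv_congr hA.1 hx ((hB.covDeriv hC).sub (hC.covDeriv hB))
      fun y hy => covDeriv_sub_covDeriv hB hC hy]
  have h2 : (minSmoothness ℝ 2) ≤ (∞ : WithTop ℕ∞) := by
    simpa using ENat.LEInfty.out
  have : IsManifold 𝓘(ℝ, E) (minSmoothness ℝ 3) M := by
    simpa using IsManifold.of_le (n := ∞) (m := 3) ENat.LEInfty.out
  have j := leibniz_identity_mlieBracket_apply ((hX.contMDiffAt hx).of_le h2)
      ((hY.contMDiffAt hx).of_le h2) ((hZ.contMDiffAt hx).of_le h2)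
  rw [mlieBracket_swap_apply (V := mlieBracket 𝓘(ℝ, E) X Y), mlieBracket_swap (V := X) (W := Z)] at j
  have e : mlieBracket 𝓘(ℝ, E) Y (-mlieBracket 𝓘(ℝ, E) Z X) x =
      - mlieBracket 𝓘(ℝ, E) Y (mlieBracket 𝓘(ℝ, E) Z X) x := by
    have := mlieBracket_const_smul_right (V := Y) (c := (-1 : ℝ)) ((hZ.mlieBracket hX).mdiffAt hx)
    simpa using this
  rw [e, ← key X Y Z hX hY hZ, ← key Y Z X hY hZ hX, ← key Z X Y hZ hX hY] at j
  simp only [curv, Pi.sub_apply]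
  rw [← sub_eq_zero] at j
  rw [← j]
  abel

/-- The symmetry of a curvature-like tensor under exchange of pairs. -/
theorem pair_symm_of_bianchi {ι : Type*} {R : ι → ι → ι → ι → ℝ}
    (h₁ : ∀ a b c d, R a b c d = -R b a c d) (h₂ : ∀ a b c d, R a b c d = -R a b d c)
    (h₃ : ∀ a b c d, R a b c d + R b c a d + R c a b d = 0) (a b c d : ι) :
    R a b c d = R c d a b := by
  have e₁ := h₃ a b c d
  have e₂ := h₃ b c d a
  have e₃ := h₃ c d a b
  have e₄ := h₃ d a b c
  linarith [h₁ b c a d, h₂ b c a d, h₁ b c d a, h₂ b c d a, h₁ c a b d, h₂ c a b d, h₁ a c b d,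
    h₁ a c d b, h₂ a c b d, h₁ d b c a, h₂ d b c a, h₁ b d c a, h₁ b d a c, h₂ b d a c, h₁ d a b c,
    h₂ d a b c, h₁ a d b c, h₂ a d b c, h₁ a b d c, h₂ a b d c, h₁ c d b a, h₂ c d b a,
    h₁ d a c b, h₂ d a c b]

theorem pairing_curv_pair_symm (hX : IsSmoothFieldOn U X) (hY : IsSmoothFieldOn U Y)
    (hZ : IsSmoothFieldOn U Z) (hW : IsSmoothFieldOn U W) (hx : x ∈ U) :
    pairing g (curv g X Y Z) W x = pairing g (curv g Z W X) Y x := by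
  refine pair_symm_of_bianchi (ι := {A : Π x : M, TangentSpace 𝓘(ℝ, E) x // IsSmoothFieldOn U A})
    (R := fun A B C D => pairing g (curv g A.1 B.1 C.1) D.1 x) (fun A B C D => ?_)
    (fun A B C D => pairing_curv_skew A.2 B.2 C.2 D.2 hx) (fun A B C D => ?_)
    ⟨X, hX⟩ ⟨Y, hY⟩ ⟨Z, hZ⟩ ⟨W, hW⟩
  · simp [pairing, curv_swap (X := A.1)]
  · simpa [pairing] using
      congrArg (fun v => g.inner x v (D.1 x)) (curv_bianchi (g := g) A.2 B.2 C.2 hx)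

/-! ### Kähler metrics -/

section Kahler

variable {J : Π x : M, TangentSpace 𝓘(ℝ, E) x →L[ℝ] TangentSpace 𝓘(ℝ, E) x}

theorem IsKahler.covDeriv_apply (hK : IsKahler g J) (hY : IsSmoothFieldOn U Y) (hx : x ∈ U) :
    covDeriv g X (applyField J Y) x = J x (covDeriv g X Y x) :=
  hK.parallel U Y hY x hx _

theorem IsKahler.smooth_apply (hK : IsKahler g J) (hX : IsSmoothFieldOn U X) :
    IsSmoothFieldOn U (applyField J X) :=
  hX.applyField hK.smooth

theorem IsKahler.inner_apply_left (hK : IsKahler g J) (v w : TangentSpace 𝓘(ℝ, E) x) :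
    g.inner x (J x v) w = -g.inner x v (J x w) := by
  rw [← hK.orthogonal x v, hK.sq, map_neg, neg_neg]

theorem IsKahler.inner_apply_self (hK : IsKahler g J) (v : TangentSpace 𝓘(ℝ, E) x) :
    g.inner x v (J x v) = 0 := by
  have := hK.inner_apply_left v v
  rw [g.symm] at this
  linarith

theorem IsKahler.curv_apply (hK : IsKahler g J) (hX : IsSmoothFieldOn U X)
    (hY : IsSmoothFieldOn U Y) (hZ : IsSmoothFieldOn U Z) (hx : x ∈ U) :
    curv g X Y (applyField J Z) x = J x (curv g X Y Z x) := by
  have key (A B : Π x : M, TangentSpace 𝓘(ℝ, E) x) (hA : IsSmoothFieldOn U A)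
      (hB : IsSmoothFieldOn U B) : covDeriv g A (covDeriv g B (applyField J Z)) x =
        J x (covDeriv g A (covDeriv g B Z) x) := by
    rw [covDeriv_congr (Z := applyField J (covDeriv g B Z)) hA.1 hx
      (hB.covDeriv (hK.smooth_apply hZ)) fun y hy => hK.covDeriv_apply hZ hy,
      hK.covDeriv_apply (hB.covDeriv hZ) hx]
  simp only [curv, Pi.sub_apply, map_sub]
  rw [key X Y hX hY, key Y X hY hX, hK.covDeriv_apply hZ hx]

/-- Pair symmetry turns the `J`-linearity of `R(Z, W)` into `R(J X, J Y) = R(X, Y)`. -/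
theorem IsKahler.pairing_curv_apply_apply (hK : IsKahler g J) (hX : IsSmoothFieldOn U X)
    (hY : IsSmoothFieldOn U Y) (hZ : IsSmoothFieldOn U Z) (hW : IsSmoothFieldOn U W) (hx : x ∈ U) :
    pairing g (curv g (applyField J X) (applyField J Y) Z) W x = pairing g (curv g X Y Z) W x := by
  rw [pairing_curv_pair_symm (hK.smooth_apply hX) (hK.smooth_apply hY) hZ hW hx,
    pairing_curv_pair_symm hX hY hZ hW hx]
  simp only [pairing]
  rw [hK.curv_apply hZ hW hX hx]
  exact hK.orthogonal x _ _

end Kahler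

end LeviCivita

end KahlerFoliation

namespace KahlerFoliation

/-! ### Totally geodesic foliations by complex curves -/

section Foliation

variable {E : Type*} [NormedAddCommGroup E] [NormedSpace ℝ E] [FiniteDimensional ℝ E]
  {M : Type*} [TopologicalSpace M] [ChartedSpace E M] [IsManifold 𝓘(ℝ, E) ∞ M]

/-- `D` is the tangent distribution of a totally geodesic foliation of the Kähler manifold
`(M, g, J)` by complex curves. -/
structure IsGeodesicComplexFoliation (g : Metric E M)
    (J : Π x : M, TangentSpace 𝓘(ℝ, E) x →L[ℝ] TangentSpace 𝓘(ℝ, E) x)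
    (D : Π x : M, Submodule ℝ (TangentSpace 𝓘(ℝ, E) x)) : Prop where
  kahler : IsKahler g J
  foliation : IsFoliation 2 D
  complex : IsComplexDistribution J D
  geodesic : IsTotallyGeodesic g D

/-- `V` is a section of length one of `D` over `U`; since `D` is complex of real rank `2`, the fields
`V`, `J V` are then an orthonormal frame of `D`. -/
structure IsUnitSectionOn (g : Metric E M)
    (J : Π x : M, TangentSpace 𝓘(ℝ, E) x →L[ℝ] TangentSpace 𝓘(ℝ, E) x)
    (D : Π x : M, Submodule ℝ (TangentSpace 𝓘(ℝ, E) x)) (U : Set M)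
    (V : Π x : M, TangentSpace 𝓘(ℝ, E) x) : Prop where
  isSection : IsSectionOn D U V
  norm_one : ∀ y ∈ U, g.inner y (V y) (V y) = 1
  eq_of_mem : ∀ y ∈ U, ∀ w ∈ D y,
    g.inner y w (V y) • V y + g.inner y w (J y (V y)) • J y (V y) = w

/-- The component of `X` in the distribution spanned by `V` and `J V`, for orthonormal
`V`, `J V`. -/
noncomputable def tangPart (g : Metric E M)
    (J : Π x : M, TangentSpace 𝓘(ℝ, E) x →L[ℝ] TangentSpace 𝓘(ℝ, E) x)
    (V X : Π x : M, TangentSpace 𝓘(ℝ, E) x) : Π x : M, TangentSpace 𝓘(ℝ, E) x :=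
  pairing g X V • V + pairing g X (applyField J V) • applyField J V

/-- The component of `X` orthogonal to `V` and `J V`, for orthonormal `V`, `J V`. -/
noncomputable def norPart (g : Metric E M)
    (J : Π x : M, TangentSpace 𝓘(ℝ, E) x →L[ℝ] TangentSpace 𝓘(ℝ, E) x)
    (V X : Π x : M, TangentSpace 𝓘(ℝ, E) x) : Π x : M, TangentSpace 𝓘(ℝ, E) x :=
  X - tangPart g J V X

variable {g : Metric E M} {U : Set M} {f h : M → ℝ}
  {J : Π x : M, TangentSpace 𝓘(ℝ, E) x →L[ℝ] TangentSpace 𝓘(ℝ, E) x}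
  {D : Π x : M, Submodule ℝ (TangentSpace 𝓘(ℝ, E) x)}
  {A B V X Y Z W : Π x : M, TangentSpace 𝓘(ℝ, E) x} {x : M}

theorem IsSectionOn.mono (hX : IsSectionOn D U X) {U' : Set M} (hU' : IsOpen U') (h : U' ⊆ U) :
    IsSectionOn D U' X :=
  ⟨hX.1.mono hU' h, fun y hy => hX.2 y (h hy)⟩

theorem IsSectionOn.add (hX : IsSectionOn D U X) (hY : IsSectionOn D U Y) :
    IsSectionOn D U (X + Y) :=
  ⟨hX.1.add hY.1, fun y hy => (D y).add_mem (hX.2 y hy) (hY.2 y hy)⟩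

theorem IsSectionOn.smul (hf : IsSmoothFunOn (E := E) U f) (hX : IsSectionOn D U X) :
    IsSectionOn D U (f • X) :=
  ⟨hX.1.smul hf, fun y hy => (D y).smul_mem _ (hX.2 y hy)⟩

theorem IsUnitSectionOn.mono (hV : IsUnitSectionOn g J D U V) {U' : Set M} (hU' : IsOpen U')
    (h : U' ⊆ U) : IsUnitSectionOn g J D U' V :=
  ⟨hV.1.mono hU' h, fun y hy => hV.2 y (h hy), fun y hy => hV.3 y (h hy)⟩

theorem pairing_eq_zero (hX : IsSectionOn D U X) (hY : IsSectionOn (orth g D) U Y) (hx : x ∈ U) :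
    pairing g X Y x = 0 :=
  (g.symm x _ _).trans (hY.2 x hx _ (hX.2 x hx))

namespace IsGeodesicComplexFoliation

variable (hF : IsGeodesicComplexFoliation g J D)
include hF

theorem isSectionOn_apply (hX : IsSectionOn D U X) : IsSectionOn D U (applyField J X) :=
  ⟨hF.kahler.smooth_apply hX.1, fun y hy => hF.complex y _ (hX.2 y hy)⟩

theorem apply_mem_orth {v : TangentSpace 𝓘(ℝ, E) x} (hv : v ∈ orth g D x) :
    J x v ∈ orth g D x := fun w hw => by
  rw [hF.kahler.inner_apply_left, hv _ (hF.complex x w hw), neg_zero]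

theorem isSectionOn_orth_apply (hX : IsSectionOn (orth g D) U X) :
    IsSectionOn (orth g D) U (applyField J X) :=
  ⟨hF.kahler.smooth_apply hX.1, fun y hy => hF.apply_mem_orth (hX.2 y hy)⟩

theorem exists_unitSection (x : M) : ∃ (U : Set M) (V : Π x : M, TangentSpace 𝓘(ℝ, E) x),
    IsOpen U ∧ x ∈ U ∧ IsUnitSectionOn g J D U V := by
  obtain ⟨U, X, hU, hx, hX, hspan⟩ := hF.foliation.exists_frame x
  have h0 (y) (hy : y ∈ U) : 0 < pairing g (X 0) (X 0) y :=
    g.pos y _ ((hspan y hy).1.ne_zero 0)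
  set V : Π x : M, TangentSpace 𝓘(ℝ, E) x := (fun y => (√(pairing g (X 0) (X 0) y))⁻¹) • X 0
    with hVdef
  have hV : IsSectionOn D U V := by
    refine IsSectionOn.smul ((isSmoothFunOn_pairing g (hX 0) (hX 0)).comp (fun t => (√t)⁻¹)
      fun y hy => ?_) ⟨hX 0, fun y hy => ?_⟩
    · exact (Real.contDiffAt_sqrt (h0 y hy).ne').inv (Real.sqrt_ne_zero'.2 (h0 y hy))
    · rw [← (hspan y hy).2]
      exact Submodule.subset_span ⟨0, rfl⟩
  have hone (y) (hy : y ∈ U) : g.inner y (V y) (V y) = 1 := by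
    have hp : g.inner y (X 0 y) (X 0 y) =
        √(pairing g (X 0) (X 0) y) * √(pairing g (X 0) (X 0) y) :=
      (Real.mul_self_sqrt (h0 y hy).le).symm
    have hs := Real.sqrt_ne_zero'.2 (h0 y hy)
    simp [hVdef, hp]
    field_simp
  refine ⟨U, V, hU, hx, hV, hone, fun y hy w hw => ?_⟩
  have hJone : g.inner y (J y (V y)) (J y (V y)) = 1 := by rw [hF.kahler.orthogonal, hone y hy]
  have horth := hF.kahler.inner_apply_self (V y)
  have horth' := (g.symm y _ _).trans horth
  have hli : LinearIndependent ℝ ![V y, J y (V y)] := by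
    rw [LinearIndependent.pair_iff]
    intro a b hab
    have e1 := congrArg (g.inner y (V y)) hab
    have e2 := congrArg (g.inner y (J y (V y))) hab
    simp only [map_add, map_smul, hone y hy, horth, horth', hJone, map_zero, smul_eq_mul] at e1 e2
    constructor <;> linarith
  have hle : Submodule.span ℝ (Set.range ![V y, J y (V y)]) ≤ D y := by
    rw [Submodule.span_le]
    rintro _ ⟨i, rfl⟩
    fin_cases i
    · exact hV.2 y hy
    · exact hF.complex y _ (hV.2 y hy)
  have hfin : Module.finrank ℝ (Submodule.span ℝ (Set.range ![V y, J y (V y)])) =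
      Module.finrank ℝ (D y) := by
    rw [finrank_span_eq_card hli, ← (hspan y hy).2, finrank_span_eq_card (hspan y hy).1]
  rw [← Submodule.eq_of_le_of_finrank_eq hle hfin] at hw
  simp only [Matrix.range_cons, Matrix.range_empty, Set.union_empty, Set.singleton_union] at hw
  obtain ⟨a, b, rfl⟩ := Submodule.mem_span_pair.1 hw
  simp [hone y hy, horth, horth', hJone]

/-! ### Components tangent and normal to the leaves -/

section frame

variable (hV : IsUnitSectionOn g J D U V)
include hV

theorem inner_V_JV (_hx : x ∈ U) : g.inner x (V x) (J x (V x)) = 0 :=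
  hF.kahler.inner_apply_self _

theorem inner_JV_V (hx : x ∈ U) : g.inner x (J x (V x)) (V x) = 0 :=
  (g.symm x _ _).trans (hF.inner_V_JV hV hx)

theorem inner_JV_JV (hx : x ∈ U) : g.inner x (J x (V x)) (J x (V x)) = 1 := by
  rw [hF.kahler.orthogonal, hV.norm_one x hx]

theorem mem_orth_iff (hx : x ∈ U) {v : TangentSpace 𝓘(ℝ, E) x} :
    v ∈ orth g D x ↔ g.inner x v (V x) = 0 ∧ g.inner x v (J x (V x)) = 0 := by
  refine ⟨fun h => ⟨h _ (hV.1.2 x hx), h _ (hF.complex x _ (hV.1.2 x hx))⟩, fun h w hw => ?_⟩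
  rw [← hV.eq_of_mem x hx w hw]
  simp [h.1, h.2]

theorem isSectionOn_tangPart (hX : IsSmoothFieldOn U X) : IsSectionOn D U (tangPart g J V X) :=
  (hV.1.smul (isSmoothFunOn_pairing g hX hV.1.1)).add ((hF.isSectionOn_apply hV.1).smul
    (isSmoothFunOn_pairing g hX (hF.kahler.smooth_apply hV.1.1)))

theorem isSectionOn_norPart (hX : IsSmoothFieldOn U X) :
    IsSectionOn (orth g D) U (norPart g J V X) := by
  refine ⟨hX.sub (hF.isSectionOn_tangPart hV hX).1, fun y hy => ?_⟩
  rw [hF.mem_orth_iff hV hy]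
  simp [norPart, tangPart, pairing, applyField, hF.inner_V_JV hV hy, hF.inner_JV_V hV hy,
    hF.inner_JV_JV hV hy, hV.norm_one y hy]

theorem norPart_add_tangPart : norPart g J V X + tangPart g J V X = X := by
  simp [norPart]

theorem tangPart_apply : tangPart g J V (applyField J X) = applyField J (tangPart g J V X) := by
  ext y
  simp [tangPart, pairing, applyField, hF.kahler.inner_apply_left, hF.kahler.sq]
  abel

theorem norPart_apply : norPart g J V (applyField J X) = applyField J (norPart g J V X) := by
  rw [norPart, hF.tangPart_apply hV]
  ext y
  simp [norPart, applyField]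

theorem exists_orth_extension (hx : x ∈ U) {v : TangentSpace 𝓘(ℝ, E) x} (hv : v ∈ orth g D x) :
    ∃ (U' : Set M) (X : Π x : M, TangentSpace 𝓘(ℝ, E) x), IsOpen U' ∧ x ∈ U' ∧ U' ⊆ U ∧
      IsSectionOn (orth g D) U' X ∧ X x = v := by
  obtain ⟨U₁, Z, hx₁, hZ, rfl⟩ := exists_smooth_extension x v
  have hO : IsOpen (U ∩ U₁) := hV.1.1.1.inter hZ.1
  refine ⟨_, norPart g J V Z, hO, ⟨hx, hx₁⟩, Set.inter_subset_left,
    hF.isSectionOn_norPart (hV.mono hO Set.inter_subset_left) (hZ.mono hO Set.inter_subset_right),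
    ?_⟩
  have := (hF.mem_orth_iff hV hx).1 hv
  simp [norPart, tangPart, pairing, applyField, this.1, this.2]

end frame

/-! ### Leaves are totally geodesic -/

theorem covDeriv_mem (hA : IsSectionOn D U A) (hB : IsSectionOn D U B) (hx : x ∈ U) :
    covDeriv g A B x ∈ D x := by
  have h1 := hF.geodesic U _ (hA.add hB) x hx
  have h2 : covDeriv g (A + B) (A + B) x = covDeriv g A A x + covDeriv g B B x +
      (covDeriv g A B x + covDeriv g B A x) := by
    rw [covDeriv_add_right hA.1 hB.1 hx]
    simp only [covDeriv, Pi.add_apply, map_add]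
    abel
  have h3 : covDeriv g A B x = (1 / 2 : ℝ) • (covDeriv g (A + B) (A + B) x
      - covDeriv g A A x - covDeriv g B B x + mlieBracket 𝓘(ℝ, E) A B x) := by
    rw [h2, ← covDeriv_sub_covDeriv (g := g) hA.1 hB.1 hx]
    module
  rw [h3]
  exact (D x).smul_mem _ ((D x).add_mem ((D x).sub_mem ((D x).sub_mem h1
    (hF.geodesic U _ hA x hx)) (hF.geodesic U _ hB x hx)) (hF.foliation.involutive U A B hA hB x hx))

theorem leviCivita_mem (hW : IsSectionOn D U W) (hx : x ∈ U) {v : TangentSpace 𝓘(ℝ, E) x}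
    (hv : v ∈ D x) : leviCivita g W x v ∈ D x := by
  obtain ⟨U', V, hU', hx', hV⟩ := hF.exists_unitSection x
  have hO : IsOpen (U ∩ U') := hW.1.1.inter hU'
  have hV' := hV.mono hO Set.inter_subset_right
  have hW' := hW.mono hO Set.inter_subset_left
  rw [← hV.eq_of_mem x hx' v hv, map_add, map_smul, map_smul]
  exact (D x).add_mem ((D x).smul_mem _ (hF.covDeriv_mem hV'.1 hW' ⟨hx, hx'⟩))
    ((D x).smul_mem _ (hF.covDeriv_mem (hF.isSectionOn_apply hV'.1) hW' ⟨hx, hx'⟩))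

/-- Differentiating along the field `X` a section of `D`, only the component of `X` normal to the
leaves contributes to the normal part. -/
theorem inner_leviCivita_norPart (hV : IsUnitSectionOn g J D U V) (hW : IsSectionOn D U W)
    (hX : IsSmoothFieldOn U X) (hx : x ∈ U) {w : TangentSpace 𝓘(ℝ, E) x} (hw : w ∈ orth g D x) :
    g.inner x (covDeriv g (norPart g J V X) W x) w = g.inner x (covDeriv g X W x) w := by
  have h := g.symm x _ _ |>.trans (hw _ (hF.leviCivita_mem hW hx
    ((hF.isSectionOn_tangPart hV hX).2 x hx)))
  conv_rhs => rw [← hF.norPart_add_tangPart hV (X := X)]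
  simp only [covDeriv, Pi.add_apply, map_add, add_apply, h, add_zero]

end IsGeodesicComplexFoliation

end Foliation

end KahlerFoliation

namespace KahlerFoliation

/-! ### The second fundamental form of the normal distribution -/

section SecondFundamentalForm

variable {E : Type*} [NormedAddCommGroup E] [NormedSpace ℝ E] [FiniteDimensional ℝ E]
  {M : Type*} [TopologicalSpace M] [ChartedSpace E M] [IsManifold 𝓘(ℝ, E) ∞ M]

/-- The derivative in the direction `A` of the tensor `(W, X, Y) ↦ g(∇_X W, Y)`, where `W` is
tangent and `Y` is normal to the leaves, with respect to the connections which `∇` induces on `D`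
and `D^⊥`. The unit section `V` of `D` serves to express the projections. -/
noncomputable def derivForm (g : Metric E M)
    (J : Π x : M, TangentSpace 𝓘(ℝ, E) x →L[ℝ] TangentSpace 𝓘(ℝ, E) x)
    (V A W X Y : Π x : M, TangentSpace 𝓘(ℝ, E) x) (x : M) : ℝ :=
  dirDeriv (pairing g (covDeriv g X W) Y) A x
    - pairing g (covDeriv g X (tangPart g J V (covDeriv g A W))) Y x
    - pairing g (covDeriv g (covDeriv g A X) W) Y x
    - pairing g (covDeriv g X W) (norPart g J V (covDeriv g A Y)) x

/-- The form `(X, Y) ↦ g(∇_X W, Y)` on `D^⊥` is skew for all sections `W` of `D` over `U`; this says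
that the foliation is Riemannian over `U`. -/
def IsRiemannianOn (g : Metric E M) (D : Π x : M, Submodule ℝ (TangentSpace 𝓘(ℝ, E) x))
    (U : Set M) : Prop :=
  ∀ W X Y : Π x : M, TangentSpace 𝓘(ℝ, E) x, IsSectionOn D U W → IsSectionOn (orth g D) U X →
    IsSectionOn (orth g D) U Y → ∀ x ∈ U,
      pairing g (covDeriv g X W) Y x = -pairing g (covDeriv g Y W) X x

variable {g : Metric E M} {U : Set M} {f h : M → ℝ}
  {J : Π x : M, TangentSpace 𝓘(ℝ, E) x →L[ℝ] TangentSpace 𝓘(ℝ, E) x}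
  {D : Π x : M, Submodule ℝ (TangentSpace 𝓘(ℝ, E) x)}
  {A B V X Y Z W : Π x : M, TangentSpace 𝓘(ℝ, E) x} {x : M}

theorem dirDeriv_neg : dirDeriv (-f) X x = -dirDeriv f X x := by
  simp [dirDeriv]

theorem pairing_neg_right : pairing g X (-Y) = -pairing g X Y := by
  ext y; simp [pairing]

namespace IsGeodesicComplexFoliation

variable (hF : IsGeodesicComplexFoliation g J D) (hV : IsUnitSectionOn g J D U V)
include hF hV

/-- The Codazzi equation: the curvature in terms of the derivative of the second fundamental
form. -/
theorem pairing_curv_eq (hA : IsSmoothFieldOn U A) (hX : IsSmoothFieldOn U X)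
    (hW : IsSectionOn D U W) (hY : IsSectionOn (orth g D) U Y) (hx : x ∈ U) :
    pairing g (curv g A X W) Y x = derivForm g J V A W X Y x - derivForm g J V X W A Y x := by
  have key (A X : Π x : M, TangentSpace 𝓘(ℝ, E) x) (hA : IsSmoothFieldOn U A)
      (hX : IsSmoothFieldOn U X) : pairing g (covDeriv g A (covDeriv g X W)) Y x =
      dirDeriv (pairing g (covDeriv g X W) Y) A x
      - pairing g (covDeriv g X W) (norPart g J V (covDeriv g A Y)) x
      + pairing g (covDeriv g A (tangPart g J V (covDeriv g X W))) Y x := by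
    have hS := hF.isSectionOn_tangPart hV (hX.covDeriv (g := g) hW.1)
    have h1 := dirDeriv_pairing (g := g) hA (hX.covDeriv (g := g) hW.1) hY.1 hx
    have h2 := dirDeriv_pairing (g := g) hA hS.1 hY.1 hx
    rw [dirDeriv_congr hA.1 hx (f₂ := fun _ => 0) fun y hy => pairing_eq_zero hS hY hy,
      dirDeriv_const] at h2
    have h3 : pairing g (tangPart g J V (covDeriv g X W)) (covDeriv g A Y) x +
        pairing g (covDeriv g X W) (norPart g J V (covDeriv g A Y)) x =
        pairing g (covDeriv g X W) (covDeriv g A Y) x := by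
      simp only [pairing, norPart, tangPart, applyField, Pi.add_apply, Pi.sub_apply, Pi.smul_apply',
        map_add, map_sub, map_smul, add_apply, smul_apply, smul_eq_mul]
      rw [g.symm x (V x), g.symm x (J x (V x))]
      ring
    linarith
  have hb : pairing g (covDeriv g (mlieBracket 𝓘(ℝ, E) A X) W) Y x =
      pairing g (covDeriv g (covDeriv g A X) W) Y x
      - pairing g (covDeriv g (covDeriv g X A) W) Y x := by
    simp only [pairing, covDeriv]
    rw [← covDeriv_sub_covDeriv (g := g) hA hX hx]
    simp [covDeriv]
  have h1 := key A X hA hX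
  have h2 := key X A hX hA
  have h3 : pairing g (curv g A X W) Y x = pairing g (covDeriv g A (covDeriv g X W)) Y x
      - pairing g (covDeriv g X (covDeriv g A W)) Y x
      - pairing g (covDeriv g (mlieBracket 𝓘(ℝ, E) A X) W) Y x := by
    simp [pairing, curv]
  rw [h3, hb, h1, h2, derivForm, derivForm]
  ring

theorem derivForm_neg_right (hY : IsSmoothFieldOn U Y) (hx : x ∈ U) :
    derivForm g J V A W X (-Y) x = -derivForm g J V A W X Y x := by
  have h : norPart g J V (covDeriv g A (-Y)) x = -norPart g J V (covDeriv g A Y) x := by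
    simp [norPart, tangPart, pairing, covDeriv_neg_right hY hx]
    module
  simp only [derivForm, pairing_neg_right, dirDeriv_neg, Pi.neg_apply]
  simp only [pairing, h, map_neg]
  ring

theorem derivForm_apply_left (hA : IsSmoothFieldOn U A)
    (hW : IsSectionOn D U W) (hY : IsSmoothFieldOn U Y) (hx : x ∈ U) :
    derivForm g J V A (applyField J W) X Y x = -derivForm g J V A W X (applyField J Y) x := by
  have hK := hF.kahler
  have hS := (hF.isSectionOn_tangPart hV (hA.covDeriv (g := g) hW.1)).1
  have h1 : dirDeriv (pairing g (covDeriv g X (applyField J W)) Y) A x =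
      -dirDeriv (pairing g (covDeriv g X W) (applyField J Y)) A x := by
    rw [← dirDeriv_neg]
    refine dirDeriv_congr hA.1 hx fun y hy => ?_
    simp [pairing, hK.covDeriv_apply hW.1 hy, applyField, hK.inner_apply_left]
  have h2 : pairing g (covDeriv g X (tangPart g J V (covDeriv g A (applyField J W)))) Y x =
      -pairing g (covDeriv g X (tangPart g J V (covDeriv g A W))) (applyField J Y) x := by
    have : covDeriv g X (tangPart g J V (covDeriv g A (applyField J W))) x =
        J x (covDeriv g X (tangPart g J V (covDeriv g A W)) x) := by
      rw [← hK.covDeriv_apply hS hx]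
      refine (covDeriv_congr hA.1 hx (hK.smooth_apply hS) fun y hy => ?_).symm
      rw [← hF.tangPart_apply hV]
      simp only [tangPart, pairing, Pi.add_apply, Pi.smul_apply', hK.covDeriv_apply hW.1 hy]
      rfl
    simp [pairing, this, applyField, hK.inner_apply_left]
  have h3 : pairing g (covDeriv g (covDeriv g A X) (applyField J W)) Y x =
      -pairing g (covDeriv g (covDeriv g A X) W) (applyField J Y) x := by
    simp [pairing, hK.covDeriv_apply hW.1 hx, applyField, hK.inner_apply_left]
  have h4 : norPart g J V (covDeriv g A (applyField J Y)) x =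
      J x (norPart g J V (covDeriv g A Y) x) := by
    have := congrFun (hF.norPart_apply hV (X := covDeriv g A Y)) x
    refine Eq.trans ?_ this
    simp only [norPart, tangPart, pairing, Pi.add_apply, Pi.sub_apply, Pi.smul_apply',
      hK.covDeriv_apply hY hx]
    rfl
  have h5 : pairing g (covDeriv g X (applyField J W)) (norPart g J V (covDeriv g A Y)) x =
      - pairing g (covDeriv g X W) (norPart g J V (covDeriv g A (applyField J Y))) x := by
    simp only [pairing, h4, hK.covDeriv_apply hW.1 hx, hK.inner_apply_left]
  simp only [derivForm, h1, h2, h3, h5]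
  ring

variable (hR : IsRiemannianOn g D U)
include hR

theorem derivForm_skew (hA : IsSmoothFieldOn U A) (hW : IsSectionOn D U W)
    (hX : IsSectionOn (orth g D) U X) (hY : IsSectionOn (orth g D) U Y) (hx : x ∈ U) :
    derivForm g J V A W X Y x = -derivForm g J V A W Y X x := by
  have hS := hF.isSectionOn_tangPart hV (hA.covDeriv (g := g) hW.1)
  have h1 : dirDeriv (pairing g (covDeriv g X W) Y) A x =
      -dirDeriv (pairing g (covDeriv g Y W) X) A x := by
    rw [← dirDeriv_neg]
    exact dirDeriv_congr hA.1 hx fun y hy => hR W X Y hW hX hY y hy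
  have h2 := hR _ X Y hS hX hY x hx
  have key (X Y : Π x : M, TangentSpace 𝓘(ℝ, E) x) (hX : IsSectionOn (orth g D) U X)
      (hY : IsSectionOn (orth g D) U Y) : pairing g (covDeriv g (covDeriv g A X) W) Y x =
      -pairing g (covDeriv g Y W) (norPart g J V (covDeriv g A X)) x := by
    have hAX := hA.covDeriv (g := g) hX.1
    rw [← hR W _ Y hW (hF.isSectionOn_norPart hV hAX) hY x hx]
    exact (hF.inner_leviCivita_norPart hV hW hAX hx (hY.2 x hx)).symm
  have h3 := key X Y hX hY
  have h4 := key Y X hY hX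
  simp only [derivForm]
  linarith

theorem derivForm_apply_apply (hA : IsSmoothFieldOn U A) (hW : IsSectionOn D U W)
    (hX : IsSectionOn (orth g D) U X) (hY : IsSectionOn (orth g D) U Y) (hx : x ∈ U) :
    derivForm g J V A W (applyField J X) (applyField J Y) x = -derivForm g J V A W X Y x := by
  have hJW := hF.isSectionOn_apply hW
  have hJX := hF.isSectionOn_orth_apply hX
  have hJY := hF.isSectionOn_orth_apply hY
  have hJJ : applyField J (applyField J Y) = -Y := by
    ext y
    exact hF.kahler.sq y _
  rw [hF.derivForm_skew hV hR hA hW hJX hJY hx, ← hF.derivForm_apply_left hV hA hW hX.1 hx,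
    hF.derivForm_skew hV hR hA hJW hJY hX hx, hF.derivForm_apply_left hV hA hW hJY.1 hx,
    hJJ, hF.derivForm_neg_right hV hY.1 hx]
  ring

/-- The second fundamental form of `D^⊥` is parallel in the directions normal to the leaves. By the
Bianchi identity and pair symmetry, `g(R(X, Y) W, Z)` is up to sign the derivative
`(∇_Z c)(W; X, Y)`; the former is invariant and the latter anti-invariant when `J` is applied to
`X` and `Y`. -/
theorem derivForm_eq_zero_of_normal (hZ : IsSectionOn (orth g D) U Z) (hW : IsSectionOn D U W)
    (hX : IsSectionOn (orth g D) U X) (hY : IsSectionOn (orth g D) U Y) (hx : x ∈ U) :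
    derivForm g J V Z W X Y x = 0 := by
  have key (X Y : Π x : M, TangentSpace 𝓘(ℝ, E) x) (hX : IsSectionOn (orth g D) U X)
      (hY : IsSectionOn (orth g D) U Y) :
      pairing g (curv g X Y W) Z x = -derivForm g J V Z W X Y x := by
    have b := congrArg (fun v => g.inner x v (Z x)) (curv_bianchi (g := g) hX.1 hY.1 hW.1 hx)
    simp only [map_add, add_apply, map_zero, zero_apply] at b
    change pairing g (curv g X Y W) Z x + pairing g (curv g Y W X) Z x
      + pairing g (curv g W X Y) Z x = 0 at b
    have b' := b
    rw [pairing_curv_pair_symm hY.1 hW.1 hX.1 hZ.1 hx, pairing_curv_skew hX.1 hZ.1 hY.1 hW.1 hx,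
      pairing_curv_pair_symm hW.1 hX.1 hY.1 hZ.1 hx, hF.pairing_curv_eq hV hX.1 hZ.1 hW hY hx,
      hF.pairing_curv_eq hV hY.1 hZ.1 hW hX hx, hF.pairing_curv_eq hV hX.1 hY.1 hW hZ hx] at b
    rw [hF.pairing_curv_eq hV hX.1 hY.1 hW hZ hx]
    have s1 := hF.derivForm_skew hV hR hX.1 hW hY hZ hx
    have s2 := hF.derivForm_skew hV hR hY.1 hW hX hZ hx
    have s3 := hF.derivForm_skew hV hR hZ.1 hW hX hY hx
    linarith
  have h1 := key X Y hX hY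
  have h2 := key _ _ (hF.isSectionOn_orth_apply hX) (hF.isSectionOn_orth_apply hY)
  rw [hF.kahler.pairing_curv_apply_apply hX.1 hY.1 hW.1 hZ.1 hx,
    hF.derivForm_apply_apply hV hR hZ.1 hW hX hY hx] at h2
  linarith

/-- In the directions tangent to the leaves, the derivative of the second fundamental form of `D^⊥`
is skew in its two tangential arguments: this is pair symmetry, since
`g(R(A, X) W, Y) = (∇_A c)(W; X, Y) - g((∇_X A)_⊥, (∇_Y W)_⊥)`. -/
theorem derivForm_swap (hA : IsSectionOn D U A) (hW : IsSectionOn D U W)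
    (hX : IsSectionOn (orth g D) U X) (hY : IsSectionOn (orth g D) U Y) (hx : x ∈ U) :
    derivForm g J V A W X Y x = -derivForm g J V W A X Y x := by
  have key (A W X Y : Π x : M, TangentSpace 𝓘(ℝ, E) x) (hA : IsSectionOn D U A)
      (hW : IsSectionOn D U W) (hX : IsSectionOn (orth g D) U X)
      (hY : IsSectionOn (orth g D) U Y) : pairing g (curv g A X W) Y x =
      derivForm g J V A W X Y x
      - pairing g (norPart g J V (covDeriv g X A)) (norPart g J V (covDeriv g Y W)) x := by
    have hS := hF.isSectionOn_tangPart hV (hX.1.covDeriv (g := g) hW.1)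
    have hXA := hX.1.covDeriv (g := g) hA.1
    have hYW := hY.1.covDeriv (g := g) hW.1
    have hN := hF.isSectionOn_norPart hV hXA
    rw [hF.pairing_curv_eq hV hA.1 hX.1 hW hY hx, derivForm.eq_1 g J V X W A Y]
    have h1 : dirDeriv (pairing g (covDeriv g A W) Y) X x = 0 := by
      rw [dirDeriv_congr hX.1.1 hx (f₂ := fun _ => 0) fun y hy => ?_, dirDeriv_const]
      exact (g.symm y _ _).trans (hY.2 y hy _ (hF.covDeriv_mem hA hW hy))
    have h2 : pairing g (covDeriv g A (tangPart g J V (covDeriv g X W))) Y x = 0 :=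
      (g.symm x _ _).trans (hY.2 x hx _ (hF.covDeriv_mem hA hS hx))
    have h3 : pairing g (covDeriv g A W) (norPart g J V (covDeriv g X Y)) x = 0 :=
      (g.symm x _ _).trans ((hF.isSectionOn_norPart hV (hX.1.covDeriv (g := g) hY.1)).2 x hx _
        (hF.covDeriv_mem hA hW hx))
    have h4 : pairing g (covDeriv g (covDeriv g X A) W) Y x =
        -pairing g (norPart g J V (covDeriv g X A)) (norPart g J V (covDeriv g Y W)) x := by
      have e := (hF.inner_leviCivita_norPart hV hW hXA hx (hY.2 x hx)).symm.trans
        (hR W _ Y hW hN hY x hx)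
      refine e.trans (congrArg Neg.neg ?_)
      have : pairing g (tangPart g J V (covDeriv g Y W)) (norPart g J V (covDeriv g X A)) x = 0 :=
        pairing_eq_zero (hF.isSectionOn_tangPart hV hYW) hN hx
      rw [pairing_comm g (norPart g J V (covDeriv g X A))]
      conv_lhs => rw [← hF.norPart_add_tangPart hV (X := covDeriv g Y W), pairing_add_left]
      simp [this]
    rw [h1, h2, h3, h4]
    ring
  have h1 := key A W X Y hA hW hX hY
  have h2 := key W A Y X hW hA hY hX
  rw [pairing_comm g (norPart g J V (covDeriv g Y W))] at h2
  have h3 := pairing_curv_pair_symm (g := g) hA.1 hX.1 hW.1 hY.1 hx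
  have h4 := hF.derivForm_skew hV hR hW.1 hA hX hY hx
  linarith

theorem derivForm_self (hX : IsSectionOn (orth g D) U X) (hY : IsSectionOn (orth g D) U Y)
    (hW : IsSectionOn D U W) (hx : x ∈ U) : derivForm g J V W W X Y x = 0 := by
  linarith [hF.derivForm_swap hV hR hW hW hX hY hx]

theorem derivForm_apply_self (hX : IsSectionOn (orth g D) U X) (hY : IsSectionOn (orth g D) U Y)
    (hW : IsSectionOn D U W) (hx : x ∈ U) :
    derivForm g J V (applyField J W) W X Y x = 0 := by
  rw [hF.derivForm_swap hV hR (hF.isSectionOn_apply hW) hW hX hY hx,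
    hF.derivForm_apply_left hV hW.1 hW hY.1 hx,
    hF.derivForm_self hV hR hX (hF.isSectionOn_orth_apply hY) hW hx]
  simp

end IsGeodesicComplexFoliation

end SecondFundamentalForm

end KahlerFoliation

namespace KahlerFoliation

/-! ### Auxiliary facts on smooth functions and skew matrices -/

section Constancy

variable {E : Type*} [NormedAddCommGroup E] [NormedSpace ℝ E]
  {M : Type*} [TopologicalSpace M] [ChartedSpace E M] [IsManifold 𝓘(ℝ, E) ∞ M]
  {U : Set M} {x : M} {X : Π x : M, TangentSpace 𝓘(ℝ, E) x}

/-- A function with vanishing differential on an open set is locally constant there. -/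
theorem eventually_eq_of_mvfderiv_eq_zero {f : M → ℝ} (hU : IsOpen U) (hx : x ∈ U)
    (hf : IsSmoothFunOn (E := E) U f) (h : ∀ y ∈ U, mvfderiv 𝓘(ℝ, E) f y = 0) :
    ∀ᶠ y in nhds x, f y = f x := by
  set φ := extChartAt 𝓘(ℝ, E) x with hφ
  have hO : IsOpen (φ.target ∩ φ.symm ⁻¹' U) :=
    (continuousOn_extChartAt_symm (I := 𝓘(ℝ, E)) x).isOpen_inter_preimage
      (isOpen_extChartAt_target x) hU
  have hxO : φ x ∈ φ.target ∩ φ.symm ⁻¹' U :=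
    ⟨mem_extChartAt_target x, by simpa [hφ, extChartAt_to_inv] using hx⟩
  obtain ⟨ε, hε, hball⟩ := Metric.isOpen_iff.1 hO _ hxO
  have hd (z) (hz : z ∈ φ.target ∩ φ.symm ⁻¹' U) :
      HasFDerivAt (f ∘ φ.symm) (0 : E →L[ℝ] ℝ) z := by
    have hs : MDifferentiableAt 𝓘(ℝ, E) 𝓘(ℝ, E) φ.symm z :=
      ((contMDiffOn_extChartAt_symm (n := ∞) x).contMDiffAt
        ((isOpen_extChartAt_target x).mem_nhds hz.1)).mdifferentiableAt (by simp)
    have h0 : mfderiv 𝓘(ℝ, E) 𝓘(ℝ, ℝ) f (φ.symm z) = 0 := by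
      ext v
      exact congrArg (fun l => l v) (h _ hz.2)
    have hc := (hf.mdiffAt hU hz.2).hasMFDerivAt.comp z hs.hasMFDerivAt
    rw [h0] at hc
    refine (hasMFDerivAt_iff_hasFDerivAt.1 hc).congr_fderiv ?_
    ext v
    rfl
  have hnhds : φ ⁻¹' Metric.ball (φ x) ε ∈ nhds x :=
    (continuousAt_extChartAt x).preimage_mem_nhds (Metric.ball_mem_nhds _ hε)
  filter_upwards [hnhds, extChartAt_source_mem_nhds (I := 𝓘(ℝ, E)) x] with y hy hys
  have hconst := Metric.isOpen_ball.is_const_of_fderiv_eq_zero (f := f ∘ φ.symm) (𝕜 := ℝ)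
    (convex_ball (φ x) ε).isPreconnected
    (fun z hz => (hd z (hball hz)).differentiableAt.differentiableWithinAt)
    (fun z hz => (hd z (hball hz)).fderiv) hy (Metric.mem_ball_self hε)
  rwa [Function.comp_apply, Function.comp_apply, hφ, (extChartAt 𝓘(ℝ, E) x).left_inv hys,
    extChartAt_to_inv] at hconst

theorem isSmoothFunOn_sum {ι : Type*} (s : Finset ι) {F : ι → M → ℝ}
    (hF : ∀ i, IsSmoothFunOn (E := E) U (F i)) :
    IsSmoothFunOn (E := E) U (fun y => ∑ i ∈ s, F i y) := by
  classical
  induction s using Finset.induction_on with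
  | empty => simpa using isSmoothFunOn_const 0
  | insert a s ha ih =>
    simp only [Finset.sum_insert ha]
    exact (hF a).add ih

theorem dirDeriv_sum {ι : Type*} (s : Finset ι) {F : ι → M → ℝ} (hU : IsOpen U) (hx : x ∈ U)
    (hF : ∀ i, IsSmoothFunOn (E := E) U (F i)) :
    dirDeriv (fun y => ∑ i ∈ s, F i y) X x = ∑ i ∈ s, dirDeriv (F i) X x := by
  classical
  induction s using Finset.induction_on with
  | empty => simpa using dirDeriv_const 0
  | insert a s ha ih =>
    simp only [Finset.sum_insert ha]
    rw [← ih]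
    exact dirDeriv_add ((hF a).mdiffAt hU hx) ((isSmoothFunOn_sum s hF).mdiffAt hU hx)

end Constancy

section Skew

variable {ι : Type*} [Fintype ι]

/-- Rotating the second index of `c` infinitesimally does not change its norm. -/
theorem sum_mul_skew_right {c n : ι → ι → ℝ} (hn : ∀ j k, n j k = -n k j) :
    ∑ i, ∑ j, c i j * ∑ k, n j k * c i k = 0 := by
  refine Finset.sum_eq_zero fun i _ => ?_
  have h : ∑ j, c i j * ∑ k, n j k * c i k = -∑ j, c i j * ∑ k, n j k * c i k := by
    conv_lhs => simp only [Finset.mul_sum]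
    rw [Finset.sum_comm, ← Finset.sum_neg_distrib]
    refine Finset.sum_congr rfl fun j _ => ?_
    rw [Finset.mul_sum, ← Finset.sum_neg_distrib]
    refine Finset.sum_congr rfl fun k _ => ?_
    rw [hn]
    ring
  linarith

theorem sum_mul_skew_left {c n : ι → ι → ℝ} (hn : ∀ j k, n j k = -n k j) :
    ∑ i, ∑ j, c i j * ∑ k, n i k * c k j = 0 := by
  rw [Finset.sum_comm]
  exact sum_mul_skew_right (c := fun j i => c i j) hn

end Skew

/-! ### Holomorphy where the form does not vanish -/

section Holomorphy

variable {E : Type*} [NormedAddCommGroup E] [NormedSpace ℝ E] [FiniteDimensional ℝ E]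
  {M : Type*} [TopologicalSpace M] [ChartedSpace E M] [IsManifold 𝓘(ℝ, E) ∞ M]

/-- The foliation is holomorphic at the point `x`: for sections `W` of `D`, the normal component of
`∇W` commutes with `J` on `D^⊥` at `x`. -/
def IsHolomorphicAt (g : Metric E M)
    (J : Π x : M, TangentSpace 𝓘(ℝ, E) x →L[ℝ] TangentSpace 𝓘(ℝ, E) x)
    (D : Π x : M, Submodule ℝ (TangentSpace 𝓘(ℝ, E) x)) (x : M) : Prop :=
  ∀ (U : Set M) (W : Π x : M, TangentSpace 𝓘(ℝ, E) x), IsSectionOn D U W → x ∈ U →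
    ∀ v ∈ orth g D x, ∀ w ∈ orth g D x,
      g.inner x (leviCivita g W x (J x v)) (J x w) = g.inner x (leviCivita g W x v) w

/-- The fields `s i` form a smooth orthonormal frame of `D^⊥` over `U`. -/
structure IsNormalFrameOn (g : Metric E M) (D : Π x : M, Submodule ℝ (TangentSpace 𝓘(ℝ, E) x))
    (U : Set M) {m : ℕ} (s : Fin m → Π x : M, TangentSpace 𝓘(ℝ, E) x) : Prop where
  isSection : ∀ i, IsSectionOn (orth g D) U (s i)
  orthonormal : IsOrthonormalOn g U s
  sum_eq : ∀ y ∈ U, ∀ v ∈ orth g D y, ∑ i, g.inner y v (s i y) • s i y = v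

variable {g : Metric E M} {U : Set M} {f h : M → ℝ}
  {J : Π x : M, TangentSpace 𝓘(ℝ, E) x →L[ℝ] TangentSpace 𝓘(ℝ, E) x}
  {D : Π x : M, Submodule ℝ (TangentSpace 𝓘(ℝ, E) x)}
  {θ : Π x : M, TangentSpace 𝓘(ℝ, E) x →L[ℝ] ℝ}
  {A B V X Y Z W : Π x : M, TangentSpace 𝓘(ℝ, E) x} {x : M}
  {m : ℕ} {s : Fin m → Π x : M, TangentSpace 𝓘(ℝ, E) x}

theorem IsNormalFrameOn.mono (hs : IsNormalFrameOn g D U s) {U' : Set M} (hU' : IsOpen U')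
    (h : U' ⊆ U) : IsNormalFrameOn g D U' s :=
  ⟨fun i => (hs.1 i).mono hU' h, hs.2.mono hU' h, fun y hy => hs.3 y (h hy)⟩

/-- `(L_W g)(X, Y)` in terms of the second fundamental form of `D^⊥`. -/
theorem lieMetric_eq (hW : IsSmoothFieldOn U W) (hX : IsSmoothFieldOn U X)
    (hY : IsSmoothFieldOn U Y) (hx : x ∈ U) : lieMetric g W X Y x =
      pairing g (covDeriv g X W) Y x + pairing g (covDeriv g Y W) X x := by
  have h := dirDeriv_pairing (g := g) hW hX hY hx
  simp only [dirDeriv] at h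
  rw [lieMetric, h, ← covDeriv_sub_covDeriv (g := g) hW hX hx,
    ← covDeriv_sub_covDeriv (g := g) hW hY hx]
  simp only [pairing, map_sub, sub_apply, g.symm x (X x)]
  ring

theorem IsConformal.isRiemannianOn (hθ : IsConformal g D θ) (h0 : ∀ y ∈ U, θ y = 0) :
    IsRiemannianOn g D U := by
  intro W X Y hW hX hY x hx
  have h := hθ.lie U W X Y hW hX hY x hx
  rw [lieMetric_eq hW.1 hX.1 hY.1 hx, h0 x hx] at h
  simp only [zero_apply, zero_mul] at h
  linarith

namespace IsGeodesicComplexFoliation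

variable (hF : IsGeodesicComplexFoliation g J D)
include hF

theorem two_le_finrank (x : M) : 2 ≤ Module.finrank ℝ E := by
  obtain ⟨U, X, hU, hx, -, hspan⟩ := hF.foliation.exists_frame x
  have := (hspan x hx).1.fintype_card_le_finrank
  rwa [Fintype.card_fin] at this

theorem exists_normalFrame (hV : IsUnitSectionOn g J D U V) (hx : x ∈ U) :
    ∃ (U' : Set M) (m : ℕ) (s : Fin m → Π x : M, TangentSpace 𝓘(ℝ, E) x),
      IsOpen U' ∧ x ∈ U' ∧ U' ⊆ U ∧ IsNormalFrameOn g D U' s := by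
  have hn := hF.two_le_finrank x
  have he : IsOrthonormalOn g U ![V, applyField J V] := by
    refine ⟨fun i => ?_, fun y hy i j => ?_⟩
    · fin_cases i
      · exact hV.1.1
      · exact hF.kahler.smooth_apply hV.1.1
    · fin_cases i <;> fin_cases j
      · exact hV.norm_one y hy
      · exact hF.inner_V_JV hV hy
      · exact hF.inner_JV_V hV hy
      · exact hF.inner_JV_JV hV hy
  obtain ⟨U', t, hU', hx', hsub, ht, hte⟩ :=
    he.exists_append hV.1.1.1 hx (Module.finrank ℝ E - 2) (by omega)
  have h0 : t (Fin.castAdd _ 0) = V := hte 0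
  have h1 : t (Fin.castAdd _ 1) = applyField J V := hte 1
  have hV' := hV.mono hU' hsub
  refine ⟨U', _, fun i => t (Fin.natAdd 2 i), hU', hx', hsub, fun i => ⟨ht.1 _, fun y hy => ?_⟩,
    ⟨fun i => ht.1 _, fun y hy i j => ?_⟩, fun y hy v hv => ?_⟩
  · rw [hF.mem_orth_iff hV' hy]
    have e0 := ht.2 y hy (Fin.natAdd 2 i) (Fin.castAdd _ 0)
    have e1 := ht.2 y hy (Fin.natAdd 2 i) (Fin.castAdd _ 1)
    rw [h0, if_neg (by simp [Fin.ext_iff])] at e0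
    rw [h1, if_neg (by simp [Fin.ext_iff]; omega)] at e1
    exact ⟨e0, e1⟩
  · simpa using ht.2 y hy (Fin.natAdd 2 i) (Fin.natAdd 2 j)
  · have := ht.sum_eq hy (by omega) v
    rw [Fin.sum_univ_add, Fin.sum_univ_two, h0, h1] at this
    have hv' := (hF.mem_orth_iff hV' hy).1 hv
    simpa [applyField, hv'.1, hv'.2] using this

/-- The normal part of `∇_X W` is linear over complex functions in the section `W` of `D`. -/
theorem inner_covDeriv_eq (hV : IsUnitSectionOn g J D U V) (hW : IsSectionOn D U W) (hx : x ∈ U)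
    {w : TangentSpace 𝓘(ℝ, E) x} (hw : w ∈ orth g D x) :
    g.inner x (covDeriv g X W x) w = pairing g W V x * g.inner x (covDeriv g X V x) w
      + pairing g W (applyField J V) x * g.inner x (J x (covDeriv g X V x)) w := by
  have ha := isSmoothFunOn_pairing g hW.1 hV.1.1
  have hJV := hF.kahler.smooth_apply hV.1.1
  have hb := isSmoothFunOn_pairing g hW.1 hJV
  have hw' := (hF.mem_orth_iff hV hx).1 hw
  have h1 := (g.symm x _ _).trans hw'.1
  have h2 := (g.symm x _ _).trans hw'.2
  rw [covDeriv_congr hW.1.1 hx hW.1 (Z := tangPart g J V W)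
    fun y hy => (hV.eq_of_mem y hy _ (hW.2 y hy)).symm, tangPart,
    covDeriv_add_right (hV.1.1.smul ha) (hJV.smul hb) hx, covDeriv_smul_right ha hV.1.1 hx,
    covDeriv_smul_right hb hJV hx, hF.kahler.covDeriv_apply hV.1.1 hx]
  simp [applyField, h1, h2]

theorem isHolomorphicAt_iff (hV : IsUnitSectionOn g J D U V) (hx : x ∈ U) :
    IsHolomorphicAt g J D x ↔ ∀ v ∈ orth g D x, ∀ w ∈ orth g D x,
      g.inner x (leviCivita g V x (J x v)) (J x w) = g.inner x (leviCivita g V x v) w := by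
  refine ⟨fun h => h U V hV.1 hx, fun h U' W hW hx' v hv w hw => ?_⟩
  have hO := hV.1.1.1.inter hW.1.1
  have hV' := hV.mono hO Set.inter_subset_left
  have hW' := hW.mono hO Set.inter_subset_right
  obtain ⟨_, X, -, -, rfl⟩ := exists_smooth_extension x v
  have hJw := hF.apply_mem_orth hw
  have e1 := hF.inner_covDeriv_eq (X := X) hV' hW' ⟨hx, hx'⟩ hw
  have e2 := hF.inner_covDeriv_eq (X := applyField J X) hV' hW' ⟨hx, hx'⟩ hJw
  have h1 := h _ hv _ hw
  have h2 := h _ hv _ hJw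
  simp only [covDeriv, applyField, hF.kahler.inner_apply_left] at e1 e2 ⊢
  rw [e1, e2, h1, h2]

/-- The foliation is holomorphic at the points where `θ` does not vanish. If `ζ` is the gradient
field of `θ`, a section of `D`, then `dθ = 0` makes `g(∇_X ζ, Y)` symmetric in the normal fields `X`
and `Y`, so that it equals `θ(ζ) g(X, Y) / 2`, which is invariant under `J`. -/
theorem isHolomorphicAt_of_ne_zero (hθ : IsHomothetic g D θ) (hx : θ x ≠ 0) :
    IsHolomorphicAt g J D x := by
  obtain ⟨U, V, hU, hxU, hV⟩ := hF.exists_unitSection x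
  rw [hF.isHolomorphicAt_iff hV hxU]
  set JV := applyField J V with hJVdef
  have hJV := hF.isSectionOn_apply hV.1
  have ha := isSmoothFunOn_form hθ.conformal.smooth hV.1.1
  have hb := isSmoothFunOn_form hθ.conformal.smooth hJV.1
  set ζ : Π x : M, TangentSpace 𝓘(ℝ, E) x :=
    (fun y => θ y (V y)) • V + (fun y => θ y (JV y)) • JV with hζdef
  have hζ : IsSectionOn D U ζ := (hV.1.smul ha).add (hJV.smul hb)
  have hgrad (y) (hy : y ∈ U) (v : TangentSpace 𝓘(ℝ, E) y) : θ y v = g.inner y (ζ y) v := by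
    obtain ⟨_, Z, hyZ, hZ, rfl⟩ := exists_smooth_extension y v
    have hO := hU.inter hZ.1
    have hn := hθ.conformal.vanishes y _ ((hF.isSectionOn_norPart
      (hV.mono hO Set.inter_subset_left) (hZ.mono hO Set.inter_subset_right)).2 y ⟨hy, hyZ⟩)
    simp only [norPart, tangPart, Pi.sub_apply, Pi.add_apply, Pi.smul_apply', map_sub, map_add,
      map_smul, smul_eq_mul, pairing] at hn
    simp only [hζdef, Pi.add_apply, Pi.smul_apply', map_add, map_smul, add_apply, smul_apply,
      smul_eq_mul, hJVdef]
    rw [g.symm y (V y), g.symm y (applyField J V y)]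
    linarith
  -- `g(∇_X ζ, Y)` is half of `θ(ζ) g(X, Y)`
  have key (v) (hv : v ∈ orth g D x) (w) (hw : w ∈ orth g D x) :
      g.inner x (leviCivita g ζ x v) w = 1 / 2 * θ x (ζ x) * g.inner x v w := by
    obtain ⟨U₁, X, hU₁, hx₁, hsub₁, hX, rfl⟩ := hF.exists_orth_extension hV hxU hv
    obtain ⟨U₂, Y, hU₂, hx₂, hsub₂, hY, rfl⟩ :=
      hF.exists_orth_extension (hV.mono hU₁ hsub₁) hx₁ hw
    replace hX := hX.mono hU₂ hsub₂
    have hζ' := hζ.mono hU₂ (hsub₂.trans hsub₁)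
    have hcl := hθ.closed U₂ X Y hX.1 hY.1 x hx₂
    have z (A B : Π x : M, TangentSpace 𝓘(ℝ, E) x) (hB : IsSectionOn (orth g D) U₂ B) :
        mvfderiv 𝓘(ℝ, E) (fun y => θ y (B y)) x (A x) = 0 :=
      (dirDeriv_congr hU₂ hx₂ (f₂ := fun _ => 0)
        fun y hy => hθ.conformal.vanishes y _ (hB.2 y hy)).trans (dirDeriv_const 0)
    rw [z X Y hY, z Y X hX, hgrad x hxU, ← covDeriv_sub_covDeriv (g := g) hX.1 hY.1 hx₂,
      map_sub] at hcl
    have d (A B : Π x : M, TangentSpace 𝓘(ℝ, E) x) (hA : IsSectionOn (orth g D) U₂ A)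
        (hB : IsSectionOn (orth g D) U₂ B) :
        g.inner x (ζ x) (covDeriv g A B x) = -g.inner x (covDeriv g A ζ x) (B x) := by
      have h := dirDeriv_pairing (g := g) hA.1 hζ'.1 hB.1 hx₂
      rw [dirDeriv_congr hU₂ hx₂ (f₂ := fun _ => 0) fun y hy => pairing_eq_zero hζ' hB hy,
        dirDeriv_const] at h
      simp only [pairing] at h
      linarith
    have hlie := hθ.conformal.lie U₂ ζ X Y hζ' hX hY x hx₂
    rw [lieMetric_eq hζ'.1 hX.1 hY.1 hx₂] at hlie
    rw [d X Y hX hY, d Y X hY hX] at hcl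
    simp only [pairing, covDeriv] at hlie hcl
    linarith
  intro v hv w hw
  have hJw := hF.apply_mem_orth hw
  have hJv := hF.apply_mem_orth hv
  -- `C(w) = g(∇_{Jv} V, J w) - g(∇_v V, w)` satisfies `a C(w) - b C(J w) = 0` where `ζ = a V + b J V`,
  -- because the form of `ζ` in place of `V` vanishes
  have main (w) (hw : w ∈ orth g D x) :
      θ x (V x) * (g.inner x (leviCivita g V x (J x v)) (J x w) - g.inner x (leviCivita g V x v) w)
      + θ x (JV x) * (g.inner x (leviCivita g V x (J x v)) w
        + g.inner x (leviCivita g V x v) (J x w)) = 0 := by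
    obtain ⟨_, X, -, -, rfl⟩ := exists_smooth_extension x v
    have e1 := hF.inner_covDeriv_eq (X := X) hV hζ hxU hw
    have e2 := hF.inner_covDeriv_eq (X := applyField J X) hV hζ hxU (hF.apply_mem_orth hw)
    have p1 : pairing g ζ V x = θ x (V x) := (hgrad x hxU _).symm
    have p2 : pairing g ζ (applyField J V) x = θ x (JV x) := (hgrad x hxU _).symm
    rw [p1, p2] at e1 e2
    simp only [covDeriv, applyField, hF.kahler.inner_apply_left, hF.kahler.sq, map_neg] at e1 e2
    rw [key _ hv _ hw] at e1
    rw [key _ hJv _ (hF.apply_mem_orth hw), hF.kahler.orthogonal] at e2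
    linarith
  have m1 := main w hw
  have m2 := main _ hJw
  simp only [hF.kahler.sq, map_neg] at m2
  have hne : θ x (V x) ^ 2 + θ x (JV x) ^ 2 ≠ 0 := by
    intro h0
    have h1 : θ x (V x) = 0 := by nlinarith [sq_nonneg (θ x (V x)), sq_nonneg (θ x (JV x))]
    have h2 : θ x (JV x) = 0 := by nlinarith [sq_nonneg (θ x (V x)), sq_nonneg (θ x (JV x))]
    refine hx ?_
    ext u
    rw [hgrad x hxU]
    simp [hζdef, h1, h2]
  have hz : (θ x (V x) ^ 2 + θ x (JV x) ^ 2) *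
      (g.inner x (leviCivita g V x (J x v)) (J x w) - g.inner x (leviCivita g V x v) w) = 0 := by
    linear_combination θ x (V x) * m1 + θ x (JV x) * m2
  have := (mul_eq_zero.1 hz).resolve_left hne
  linarith

/-- Being holomorphic at each point means that `L_V J` takes values in `D`. -/
theorem isHolomorphicFoliation (h : ∀ x, IsHolomorphicAt g J D x) :
    IsHolomorphicFoliation J D := by
  intro U W X hW hX x hx
  obtain ⟨U', V, hU', hx', hV⟩ := hF.exists_unitSection x
  have hO := hX.1.inter hU'
  have hxO : x ∈ U ∩ U' := ⟨hx, hx'⟩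
  replace hV := hV.mono hO Set.inter_subset_right
  replace hW := hW.mono hO Set.inter_subset_left
  replace hX := hX.mono hO Set.inter_subset_left
  have hJX := hF.kahler.smooth_apply hX
  have e : lieEndo J W X x = J x (covDeriv g X W x) - covDeriv g (applyField J X) W x := by
    change mlieBracket 𝓘(ℝ, E) W (applyField J X) x - J x (mlieBracket 𝓘(ℝ, E) W X x) = _
    rw [← covDeriv_sub_covDeriv (g := g) hW.1 hX hxO, ← covDeriv_sub_covDeriv (g := g) hW.1 hJX hxO,
      hF.kahler.covDeriv_apply hX hxO, map_sub]
    abel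
  have hL := hF.kahler.smooth_apply (hX.covDeriv (g := g) hW.1) |>.sub (hJX.covDeriv (g := g) hW.1)
  have hN := (hF.isSectionOn_norPart hV hL).2 x hxO
  have hT := (hF.isSectionOn_tangPart hV hL).2 x hxO
  set L := applyField J (covDeriv g X W) - covDeriv g (applyField J X) W with hLdef
  suffices hzero : norPart g J V L x = 0 by
    have := congrFun (hF.norPart_add_tangPart hV (X := L)) x
    rw [Pi.add_apply, hzero, zero_add] at this
    rw [this] at hT
    rw [e]
    exact hT
  by_contra hne
  refine (g.pos x _ hne).ne' ?_
  set N := norPart g J V L x with hNdef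
  have h1 : g.inner x N N = g.inner x (L x) N := by
    have := congrFun (hF.norPart_add_tangPart hV (X := L)) x
    rw [← this, Pi.add_apply, map_add, add_apply, (g.symm x _ _).trans (hN _ hT), add_zero]
  have hn := (hF.isSectionOn_norPart hV hX).2 x hxO
  have hol := h x _ W hW hxO _ hn _ (hF.apply_mem_orth hN)
  have i1 := hF.inner_leviCivita_norPart hV hW hX hxO (hF.apply_mem_orth hN)
  have i2 := hF.inner_leviCivita_norPart hV hW hJX hxO hN
  rw [hF.norPart_apply hV] at i2
  rw [h1]
  simp only [hLdef, Pi.sub_apply, map_sub, sub_apply, applyField, hF.kahler.inner_apply_left]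
  simp only [covDeriv, applyField, hF.kahler.sq, map_neg] at i1 i2 hol ⊢
  linarith

end IsGeodesicComplexFoliation

end Holomorphy

end KahlerFoliation

namespace KahlerFoliation

/-! ### Constancy of the obstruction to holomorphy -/

section Parallel

variable {E : Type*} [NormedAddCommGroup E] [NormedSpace ℝ E] [FiniteDimensional ℝ E]
  {M : Type*} [TopologicalSpace M] [ChartedSpace E M] [IsManifold 𝓘(ℝ, E) ∞ M]
  {g : Metric E M} {U : Set M}
  {J : Π x : M, TangentSpace 𝓘(ℝ, E) x →L[ℝ] TangentSpace 𝓘(ℝ, E) x}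
  {D : Π x : M, Submodule ℝ (TangentSpace 𝓘(ℝ, E) x)}
  {θ : Π x : M, TangentSpace 𝓘(ℝ, E) x →L[ℝ] ℝ}
  {A V X Y Z W : Π x : M, TangentSpace 𝓘(ℝ, E) x} {x : M}
  {m : ℕ} {s : Fin m → Π x : M, TangentSpace 𝓘(ℝ, E) x}

/-- The obstruction `2 g(C_V (s i), s j)` to holomorphy, where `C_V` is the part of `X ↦ ∇_X V` which
anticommutes with `J`, in a frame `s` of `D^⊥`. -/
noncomputable def antiForm (g : Metric E M)
    (J : Π x : M, TangentSpace 𝓘(ℝ, E) x →L[ℝ] TangentSpace 𝓘(ℝ, E) x)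
    (V : Π x : M, TangentSpace 𝓘(ℝ, E) x) (s : Fin m → Π x : M, TangentSpace 𝓘(ℝ, E) x)
    (p : Fin m × Fin m) : M → ℝ :=
  pairing g (covDeriv g (s p.1) V) (s p.2)
    - pairing g (covDeriv g (applyField J (s p.1)) V) (applyField J (s p.2))

/-- The squared norm of the obstruction to holomorphy. -/
noncomputable def antiNormSq (g : Metric E M)
    (J : Π x : M, TangentSpace 𝓘(ℝ, E) x →L[ℝ] TangentSpace 𝓘(ℝ, E) x)
    (V : Π x : M, TangentSpace 𝓘(ℝ, E) x) (s : Fin m → Π x : M, TangentSpace 𝓘(ℝ, E) x) : M → ℝ :=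
  fun y => ∑ p, (antiForm g J V s p * antiForm g J V s p) y

namespace IsGeodesicComplexFoliation

variable (hF : IsGeodesicComplexFoliation g J D) (hV : IsUnitSectionOn g J D U V)
  (hs : IsNormalFrameOn g D U s)
include hF hV hs

theorem isSmoothFunOn_antiForm (p : Fin m × Fin m) :
    IsSmoothFunOn (E := E) U (antiForm g J V s p) :=
  (isSmoothFunOn_pairing g ((hs.1 _).1.covDeriv hV.1.1) (hs.1 _).1).sub
    (isSmoothFunOn_pairing g ((hF.kahler.smooth_apply (hs.1 _).1).covDeriv hV.1.1)
      (hF.kahler.smooth_apply (hs.1 _).1))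

theorem isSmoothFunOn_antiNormSq : IsSmoothFunOn (E := E) U (antiNormSq g J V s) :=
  isSmoothFunOn_sum _ fun p =>
    (hF.isSmoothFunOn_antiForm hV hs p).mul (hF.isSmoothFunOn_antiForm hV hs p)

theorem dirDeriv_antiNormSq (hx : x ∈ U) : dirDeriv (antiNormSq g J V s) A x =
    2 * ∑ p, antiForm g J V s p x * dirDeriv (antiForm g J V s p) A x := by
  have hsm := hF.isSmoothFunOn_antiForm hV hs
  refine (dirDeriv_sum _ hV.1.1.1 hx fun p => (hsm p).mul (hsm p)).trans ?_
  rw [Finset.mul_sum]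
  refine Finset.sum_congr rfl fun p _ => ?_
  rw [dirDeriv_mul ((hsm p).mdiffAt hV.1.1.1 hx) ((hsm p).mdiffAt hV.1.1.1 hx)]
  ring

theorem antiForm_eq_zero_of_antiNormSq (h : antiNormSq g J V s x = 0) (p : Fin m × Fin m) :
    antiForm g J V s p x = 0 := by
  have := (Finset.sum_eq_zero_iff_of_nonneg (fun p _ => mul_self_nonneg _)).1 h p
    (Finset.mem_univ p)
  exact mul_self_eq_zero.1 this

theorem isHolomorphicAt_iff_antiNormSq (hx : x ∈ U) :
    IsHolomorphicAt g J D x ↔ antiNormSq g J V s x = 0 := by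
  rw [hF.isHolomorphicAt_iff hV hx]
  refine ⟨fun h => Finset.sum_eq_zero fun p _ => ?_, fun h v hv w hw => ?_⟩
  · have := h _ ((hs.1 p.1).2 x hx) _ ((hs.1 p.2).2 x hx)
    have h0 : antiForm g J V s p x = 0 := by
      simp only [antiForm, Pi.sub_apply, pairing, covDeriv, applyField]
      rw [this, sub_self]
    simp [h0]
  · rw [← hs.sum_eq x hx v hv, ← hs.sum_eq x hx w hw]
    simp only [map_sum, map_smul, sum_apply, smul_apply]
    refine Finset.sum_congr rfl fun j _ => congrArg _ (Finset.sum_congr rfl fun i _ => ?_)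
    have h0 := hF.antiForm_eq_zero_of_antiNormSq hV hs h (i, j)
    simp only [antiForm, Pi.sub_apply, pairing, covDeriv, applyField] at h0
    rw [sub_eq_zero.1 h0]

variable (hR : IsRiemannianOn g D U)
include hR

theorem antiForm_eq (p : Fin m × Fin m) (hx : x ∈ U) :
    antiForm g J V s p x = 2 * pairing g (covDeriv g (s p.1) V) (s p.2) x := by
  have hK := hF.kahler
  have h1 := hR V _ _ hV.1 (hF.isSectionOn_orth_apply (hs.1 p.1))
    (hF.isSectionOn_orth_apply (hs.1 p.2)) x hx
  have h2 := hR _ _ _ (hF.isSectionOn_apply hV.1) (hs.1 p.2)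
    (hF.isSectionOn_orth_apply (hs.1 p.1)) x hx
  have h3 := hR _ _ _ hV.1 (hs.1 p.2) (hs.1 p.1) x hx
  have h4 := hR _ _ _ (hF.isSectionOn_apply hV.1) (hF.isSectionOn_orth_apply (hs.1 p.1))
    (hs.1 p.2) x hx
  simp only [antiForm, Pi.sub_apply]
  simp only [pairing, hK.covDeriv_apply hV.1.1 hx, applyField, hK.orthogonal,
    hK.inner_apply_left] at h1 h2 h3 h4 ⊢
  linarith

/-- Where the second fundamental form is parallel in a direction, the derivative of its norm
vanishes: the connection forms of the frames `V`, `J V` and `s` are skew. -/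
theorem sum_mul_dirDeriv_eq_zero (hA : IsSmoothFieldOn U A) (hx : x ∈ U)
    (hT : ∀ i j, derivForm g J V A V (s i) (s j) x = 0) :
    ∑ i, ∑ j, pairing g (covDeriv g (s i) V) (s j) x *
      dirDeriv (pairing g (covDeriv g (s i) V) (s j)) A x = 0 := by
  have hK := hF.kahler
  have hJV := hF.isSectionOn_apply hV.1
  set c : Fin m → Fin m → ℝ := fun i j => pairing g (covDeriv g (s i) V) (s j) x with hc
  set n : Fin m → Fin m → ℝ := fun i j => pairing g (covDeriv g A (s i)) (s j) x with hn
  set μ : Fin m → Fin m → ℝ := fun i j => g.inner x (J x (s i x)) (s j x) with hμ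
  set β : ℝ := pairing g (covDeriv g A V) (applyField J V) x with hβ
  have hn' (i j) : n i j = -n j i := by
    have h := dirDeriv_pairing (g := g) hA (hs.1 i).1 (hs.1 j).1 hx
    rw [dirDeriv_congr hA.1 hx (f₂ := fun _ => if i = j then 1 else 0)
      (by exact fun y hy => hs.2.2 y hy i j), dirDeriv_const, pairing_comm g (s i)] at h
    simp only [hn]
    linarith
  have hμ' (i j) : μ i j = -μ j i := by
    simp only [hμ]
    rw [hK.inner_apply_left, g.symm]
  have hVV : pairing g (covDeriv g A V) V x = 0 := by
    have h := dirDeriv_pairing (g := g) hA hV.1.1 hV.1.1 hx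
    rw [dirDeriv_congr hA.1 hx (f₂ := fun _ => 1) (by exact hV.norm_one), dirDeriv_const,
      pairing_comm g V] at h
    linarith
  have horth (i) : g.inner x (V x) (s i x) = 0 := pairing_eq_zero hV.1 (hs.1 i) hx
  have horth' (i) : g.inner x (J x (V x)) (s i x) = 0 := pairing_eq_zero hJV (hs.1 i) hx
  have hnor (i k) : g.inner x (norPart g J V (covDeriv g A (s i)) x) (s k x) = n i k := by
    simp [hn, norPart, tangPart, pairing, applyField, horth, horth']
  have hAs (i) := hA.covDeriv (g := g) (hs.1 i).1
  have hnorsum (i) : norPart g J V (covDeriv g A (s i)) x = ∑ k, n i k • s k x := by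
    rw [← hs.sum_eq x hx _ ((hF.isSectionOn_norPart hV (hAs i)).2 x hx)]
    simp only [hnor]
  have hJs (j) : J x (s j x) = ∑ k, μ j k • s k x :=
    (hs.sum_eq x hx _ (hF.apply_mem_orth ((hs.1 j).2 x hx))).symm
  have t1 (i j) : pairing g (covDeriv g (s i) (tangPart g J V (covDeriv g A V))) (s j) x =
      -β * ∑ k, μ j k * c i k := by
    have hAV := hA.covDeriv (g := g) hV.1.1
    have ha := isSmoothFunOn_pairing g hAV hV.1.1
    have hb := isSmoothFunOn_pairing g hAV hJV.1
    have e : ∑ k, μ j k * c i k = g.inner x (covDeriv g (s i) V x) (J x (s j x)) := by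
      rw [hJs]
      simp [hc, pairing, map_sum]
    rw [e, pairing, tangPart, covDeriv_add_right (hV.1.1.smul ha) (hJV.1.smul hb) hx,
      covDeriv_smul_right ha hV.1.1 hx, covDeriv_smul_right hb hJV.1 hx,
      hK.covDeriv_apply hV.1.1 hx, hVV]
    simp [applyField, horth, horth', hK.inner_apply_left, hβ]
  have t2 (i j) : pairing g (covDeriv g (covDeriv g A (s i)) V) (s j) x =
      ∑ k, n i k * c k j := by
    refine (hF.inner_leviCivita_norPart hV hV.1 (hAs i) hx ((hs.1 j).2 x hx)).symm.trans ?_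
    rw [covDeriv, hnorsum]
    simp [hc, pairing, map_sum, covDeriv]
  have t3 (i j) : pairing g (covDeriv g (s i) V) (norPart g J V (covDeriv g A (s j))) x =
      ∑ k, n j k * c i k := by
    rw [pairing, hnorsum]
    simp [hc, pairing, map_sum]
  have hd (i j) : dirDeriv (pairing g (covDeriv g (s i) V) (s j)) A x =
      -β * ∑ k, μ j k * c i k + ∑ k, n i k * c k j + ∑ k, n j k * c i k := by
    have := hT i j
    rw [derivForm, t1, t2, t3] at this
    linarith
  have e1 := sum_mul_skew_right (c := c) hμ'
  have e2 := sum_mul_skew_left (c := c) hn'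
  have e3 := sum_mul_skew_right (c := c) hn'
  calc _ = ∑ i, ∑ j, (-β * (c i j * ∑ k, μ j k * c i k) + c i j * ∑ k, n i k * c k j
        + c i j * ∑ k, n j k * c i k) := by
        refine Finset.sum_congr rfl fun i _ => Finset.sum_congr rfl fun j _ => ?_
        rw [hd]
        ring
    _ = 0 := by
        simp only [Finset.sum_add_distrib, ← Finset.mul_sum, e1, e2, e3]
        ring

theorem mvfderiv_antiNormSq_of_isRiemannianOn (hx : x ∈ U) :
    mvfderiv 𝓘(ℝ, E) (antiNormSq g J V s) x = 0 := by
  have key (A : Π x : M, TangentSpace 𝓘(ℝ, E) x) (hA : IsSmoothFieldOn U A)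
      (hT : ∀ i j, derivForm g J V A V (s i) (s j) x = 0) :
      mvfderiv 𝓘(ℝ, E) (antiNormSq g J V s) x (A x) = 0 := by
    refine (hF.dirDeriv_antiNormSq hV hs hx).trans ?_
    have h := hF.sum_mul_dirDeriv_eq_zero hV hs hR hA hx hT
    rw [← Fintype.sum_prod_type'] at h
    have e (p : Fin m × Fin m) : dirDeriv (antiForm g J V s p) A x =
        2 * dirDeriv (pairing g (covDeriv g (s p.1) V) (s p.2)) A x := by
      have hp := isSmoothFunOn_pairing g ((hs.1 p.1).1.covDeriv (g := g) hV.1.1) (hs.1 p.2).1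
      rw [dirDeriv_congr hA.1 hx
        (f₂ := (fun _ => (2 : ℝ)) * pairing g (covDeriv g (s p.1) V) (s p.2))
        fun y hy => hF.antiForm_eq hV hs hR p hy,
        dirDeriv_mul ((isSmoothFunOn_const 2).mdiffAt hA.1 hx) (hp.mdiffAt hA.1 hx),
        dirDeriv_const]
      ring
    calc _ = 2 * (4 * ∑ p : Fin m × Fin m, pairing g (covDeriv g (s p.1) V) (s p.2) x *
          dirDeriv (pairing g (covDeriv g (s p.1) V) (s p.2)) A x) := by
          rw [Finset.mul_sum _ _ (4 : ℝ)]
          refine congrArg _ (Finset.sum_congr rfl fun p _ => ?_)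
          rw [e, hF.antiForm_eq hV hs hR p hx]
          ring
      _ = 0 := by rw [h]; simp
  have k1 := key V hV.1.1 fun i j => hF.derivForm_self hV hR (hs.1 i) (hs.1 j) hV.1 hx
  have k2 := key _ (hF.isSectionOn_apply hV.1).1 fun i j =>
    hF.derivForm_apply_self hV hR (hs.1 i) (hs.1 j) hV.1 hx
  have k3 (k) := key _ (hs.1 k).1 fun i j =>
    hF.derivForm_eq_zero_of_normal hV hR (hs.1 k) hV.1 (hs.1 i) (hs.1 j) hx
  ext v
  obtain ⟨_, X, hxX, hX, rfl⟩ := exists_smooth_extension x v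
  have hO := hV.1.1.1.inter hX.1
  have hN := (hF.isSectionOn_norPart (hV.mono hO Set.inter_subset_left)
    (hX.mono hO Set.inter_subset_right)).2 x ⟨hx, hxX⟩
  rw [← hF.norPart_add_tangPart hV (X := X), Pi.add_apply, ← hs.sum_eq x hx _ hN, tangPart]
  simp only [Pi.add_apply, Pi.smul_apply', map_add, map_sum, map_smul, k1, k2, k3]
  simp

omit hR

/-- The squared norm of the obstruction to holomorphy has vanishing differential: where it is
positive, `θ` is zero nearby, so that the obstruction is parallel; where it is zero, it has a
minimum. -/
theorem mvfderiv_antiNormSq (hθ : IsHomothetic g D θ) (hx : x ∈ U) :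
    mvfderiv 𝓘(ℝ, E) (antiNormSq g J V s) x = 0 := by
  by_cases h0 : antiNormSq g J V s x = 0
  · ext v
    obtain ⟨_, X, -, -, rfl⟩ := exists_smooth_extension x v
    refine (hF.dirDeriv_antiNormSq hV hs hx).trans ?_
    simp [hF.antiForm_eq_zero_of_antiNormSq hV hs h0]
  · have hO := isOpen_inter_ne_zero hV.1.1.1 (hF.isSmoothFunOn_antiNormSq hV hs)
    have hsub : {y ∈ U | antiNormSq g J V s y ≠ 0} ⊆ U := fun y hy => hy.1
    refine hF.mvfderiv_antiNormSq_of_isRiemannianOn (hV.mono hO hsub) (hs.mono hO hsub)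
      (hθ.conformal.isRiemannianOn fun y hy => ?_) ⟨hx, h0⟩
    by_contra hne
    exact hy.2 ((hF.isHolomorphicAt_iff_antiNormSq hV hs hy.1).1
      (hF.isHolomorphicAt_of_ne_zero hθ hne))

omit hV hs

theorem eventually_isHolomorphicAt_iff (hθ : IsHomothetic g D θ) (x : M) :
    ∀ᶠ y in nhds x, (IsHolomorphicAt g J D y ↔ IsHolomorphicAt g J D x) := by
  obtain ⟨U', V, hU', hx', hV'⟩ := hF.exists_unitSection x
  obtain ⟨U, m, s, hU, hx, hsub, hs⟩ := hF.exists_normalFrame hV' hx'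
  have hV := hV'.mono hU hsub
  filter_upwards [hU.mem_nhds hx, eventually_eq_of_mvfderiv_eq_zero hU hx
    (hF.isSmoothFunOn_antiNormSq hV hs) fun y hy => hF.mvfderiv_antiNormSq hV hs hθ hy]
    with y hy hyx
  rw [hF.isHolomorphicAt_iff_antiNormSq hV hs hy, hF.isHolomorphicAt_iff_antiNormSq hV hs hx, hyx]

end IsGeodesicComplexFoliation

end Parallel

end KahlerFoliation

theorem theorem2p3
    {E : Type*} [NormedAddCommGroup E] [NormedSpace ℝ E] [FiniteDimensional ℝ E]
    {M : Type*} [TopologicalSpace M] [ChartedSpace E M] [IsManifold 𝓘(ℝ, E) ∞ M]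
    [T2Space M] [CompactSpace M] [ConnectedSpace M]
    (g : Metric E M)
    (J : Π x : M, TangentSpace 𝓘(ℝ, E) x →L[ℝ] TangentSpace 𝓘(ℝ, E) x)
    (hKahler : IsKahler g J)
    (D : Π x : M, Submodule ℝ (TangentSpace 𝓘(ℝ, E) x))
    (hfol : IsFoliation 2 D)
    (hcomplex : IsComplexDistribution J D)
    (θ : Π x : M, TangentSpace 𝓘(ℝ, E) x →L[ℝ] ℝ)
    (hhomothetic : IsHomothetic g D θ)
    (hgeodesic : IsTotallyGeodesic g D)
    (hθ : ∃ x : M, θ x ≠ 0) :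
    IsHolomorphicFoliation J D := by
  have hF : IsGeodesicComplexFoliation g J D := ⟨hKahler, hfol, hcomplex, hgeodesic⟩
  obtain ⟨x₀, hx₀⟩ := hθ
  have hlc : IsLocallyConstant (fun x => IsHolomorphicAt g J D x) :=
    IsLocallyConstant.iff_eventually_eq _ |>.2 fun x =>
      (hF.eventually_isHolomorphicAt_iff hhomothetic x).mono fun y hy => propext hy
  refine hF.isHolomorphicFoliation fun x => ?_
  rw [hlc.apply_eq_of_isPreconnected isPreconnected_univ (Set.mem_univ x) (Set.mem_univ x₀)]
  exact hF.isHolomorphicAt_of_ne_zero hhomothetic hx₀
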